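/- Let $q\ge 2$ be an integer and let $T$ be the homogeneous tree in which every vertex has $q+1$ neighbours, with graph distance $d$. Fix $o\in T$ and a ray $\omega_*$ (a half-infinite geodesic emanating from $o$). For $x\in T$ let $x\wedge\omega_*$ be the point of $\omega_*$ closest to $x$, let $\ell(x)=d(o,x\wedge\omega_*)-d(x,x\wedge\omega_*)$ be the level of $x$, let $s(x)$ be the set of the neighbours $y$ of $x$ with $\ell(y)=\ell(x)-1$, and let $\mu$ be the measure on $T$ with $\mu(\{x\})=\mu(x)=q^{\ell(x)}$. Let $\mathcal L$ be the flow Laplacian $$\mathcal L f(x)=f(x)-\frac1{2\sqrt q}\sum_{y\sim x}\frac{\mu(y)^{1/2}}{\mu(x)^{1/2}}f(y),$$ a bounded nonnegative self-adjoint operator on the complex Hilbert space $L^2(\mu)$. Let $\varepsilon:T\to\mathbb C$ be bounded with $\sum_{y\in s(x)}\varepsilon(y)=0$ for every $x\in T$, and put $$\nabla_{\varepsilon}f(x)=\frac1q\sum_{y\in s(x)}\varepsilon(y)f(y).$$ Then $\mathcal L^{1/2}$ is injective, the horizontal Riesz transform $\mathcal R_\varepsilon=\nabla_\varepsilon\mathcal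 L^{-1/2}$, with domain the range of $\mathcal L^{1/2}$, is densely defined in $L^2(\mu)$, its adjoint $\mathcal R_\varepsilon^*$ is defined on all of $L^2(\mu)$, and $\mathcal R_\varepsilon^*$ is of weak type $(1,1)$: the restriction of $\mathcal R_\varepsilon^*$ to $L^1(\mu)\cap L^2(\mu)$ extends to a linear operator $S$ on $L^1(\mu)$ for which there is a constant $C$ such that $$\mu(\{x\in T: |Sf(x)|>\lambda\})\le \frac{C}{\lambda}\,\|f\|_{L^1(\mu)}\qquad\text{for all } f\in L^1(\mu),\ \lambda>0.$$ -/

import Mathlib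

open MeasureTheory
open scoped ENNReal NNReal

noncomputable section

namespace FlowTree

variable {V : Type*}

/-- The homogeneous tree in which every vertex has `q + 1` neighbours, where `q ≥ 2`. -/
structure IsHomogeneousTree (G : SimpleGraph V) [G.LocallyFinite] (q : ℕ) : Prop where
  isTree : G.IsTree
  two_le : 2 ≤ q
  degree_eq : ∀ x, G.degree x = q + 1

/-- A ray: a half-infinite geodesic (for the graph distance) emanating from `o`. -/
structure IsRay (G : SimpleGraph V) (o : V) (ω : ℕ → V) : Prop where
  start : ω 0 = o
  geodesic : ∀ m k : ℕ, G.dist (ω m) (ω (m + k)) = k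

/-- The vertex of the ray `ω` closest to `x`. -/
def confluent (G : SimpleGraph V) (ω : ℕ → V) (x : V) : V :=
  ω (Function.argmin (fun n => G.dist x (ω n)))

/-- The level `ℓ(x) = d(o, x ∧ ω) - d(x, x ∧ ω)`. -/
def level (G : SimpleGraph V) (o : V) (ω : ℕ → V) (x : V) : ℤ :=
  (G.dist o (confluent G ω x) : ℤ) - (G.dist x (confluent G ω x) : ℤ)

/-- The successors of `x`: its neighbours at level `ℓ(x) - 1`. -/
def succs (G : SimpleGraph V) [G.LocallyFinite] (o : V) (ω : ℕ → V) (x : V) : Finset V :=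
  (G.neighborFinset x).filter (fun y => level G o ω y = level G o ω x - 1)

/-- The density `q ^ ℓ(x)` of the canonical flow measure. -/
def weight (G : SimpleGraph V) (q : ℕ) (o : V) (ω : ℕ → V) (x : V) : ℝ :=
  (q : ℝ) ^ (level G o ω x)

/-- The canonical flow measure `μ`, giving mass `q ^ ℓ(x)` to each vertex `x`. -/
def flowMeasure [MeasurableSpace V] (G : SimpleGraph V) (q : ℕ) (o : V) (ω : ℕ → V) :
    Measure V :=
  Measure.sum (fun x => ENNReal.ofReal (weight G q o ω x) • Measure.dirac x)

/-- The flow Laplacian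
`𝓛 f(x) = f(x) - (2 √q)⁻¹ ∑_{y ∼ x} μ(y)^{1/2} μ(x)^{-1/2} f(y)` on all functions. -/
def flowLaplacianFun (G : SimpleGraph V) [G.LocallyFinite] (q : ℕ) (o : V) (ω : ℕ → V) :
    (V → ℂ) →ₗ[ℂ] (V → ℂ) where
  toFun f x := f x - (1 / (2 * Real.sqrt q) : ℝ) *
    ∑ y ∈ G.neighborFinset x,
      (Real.sqrt (weight G q o ω y) / Real.sqrt (weight G q o ω x) : ℝ) * f y
  map_add' f g := by
    funext x
    simp only [Pi.add_apply, mul_add, Finset.sum_add_distrib]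
    ring
  map_smul' c f := by
    funext x
    simp only [Pi.smul_apply, smul_eq_mul, RingHom.id_apply, mul_sub, Finset.mul_sum]
    congr 1
    exact Finset.sum_congr rfl fun y _ => by ring

/-- The horizontal gradient `∇_ε f(x) = q⁻¹ ∑_{y ∈ s(x)} ε(y) f(y)` on all functions. -/
def horizontalGradientFun (G : SimpleGraph V) [G.LocallyFinite] (q : ℕ) (o : V) (ω : ℕ → V)
    (ε : V → ℂ) : (V → ℂ) →ₗ[ℂ] (V → ℂ) where
  toFun f x := (1 / (q : ℂ)) * ∑ y ∈ succs G o ω x, ε y * f y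
  map_add' f g := by
    funext x
    simp only [Pi.add_apply, mul_add, Finset.sum_add_distrib]
  map_smul' c f := by
    funext x
    simp only [Pi.smul_apply, smul_eq_mul, RingHom.id_apply, Finset.mul_sum]
    exact Finset.sum_congr rfl fun y _ => by ring

theorem lintegral_flowMeasure [MeasurableSpace V] [DiscreteMeasurableSpace V]
    {G : SimpleGraph V} {q : ℕ} {o : V} {ω : ℕ → V} (F : V → ℝ≥0∞) :
    ∫⁻ x, F x ∂(flowMeasure G q o ω) = ∑' x, ENNReal.ofReal (weight G q o ω x) * F x := by
  simp [flowMeasure, lintegral_sum_measure]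

section Bounds

variable {G : SimpleGraph V} [G.LocallyFinite] {q : ℕ} {o : V} {ω : ℕ → V}

theorem weight_pos (hG : IsHomogeneousTree G q) (x : V) : 0 < weight G q o ω x :=
  zpow_pos (by have := hG.two_le; exact_mod_cast (by omega : 0 < q)) _

/-- A pointwise bound by the values at a vertex and its neighbours. -/
def LocallyBounded (G : SimpleGraph V) [G.LocallyFinite] (q : ℕ) (o : V) (ω : ℕ → V)
    (A : (V → ℂ) →ₗ[ℂ] (V → ℂ)) : Prop :=
  ∃ K : ℝ≥0, ∀ f x, weight G q o ω x * ‖A f x‖ ^ 2 ≤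
    K * (weight G q o ω x * ‖f x‖ ^ 2 +
      ∑ y ∈ G.neighborFinset x, weight G q o ω y * ‖f y‖ ^ 2)

theorem flowLaplacianFun_locallyBounded (hG : IsHomogeneousTree G q) :
    LocallyBounded G q o ω (flowLaplacianFun G q o ω) := by
  refine ⟨2 * (q + 1), fun f x => ?_⟩
  have hq : (1 : ℝ) ≤ Real.sqrt q := by
    rw [Real.one_le_sqrt]; exact_mod_cast (by have := hG.two_le; omega : 1 ≤ q)
  set w := weight G q o ω with hw
  have hwp : ∀ x, 0 < w x := fun x => weight_pos hG x
  have h1 : Real.sqrt (w x) * ‖flowLaplacianFun G q o ω f x‖ ≤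
      Real.sqrt (w x) * ‖f x‖ + ∑ y ∈ G.neighborFinset x, Real.sqrt (w y) * ‖f y‖ := by
    have hx : 0 < Real.sqrt (w x) := Real.sqrt_pos.2 (hwp x)
    have hc : |1 / (2 * Real.sqrt q)| ≤ 1 := by
      rw [abs_of_nonneg (by positivity), div_le_one (by positivity)]; linarith
    have : ‖flowLaplacianFun G q o ω f x‖ ≤
        ‖f x‖ + ∑ y ∈ G.neighborFinset x, Real.sqrt (w y) / Real.sqrt (w x) * ‖f y‖ := by
      refine (norm_sub_le _ _).trans (add_le_add le_rfl ?_)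
      rw [norm_mul, Complex.norm_real, Real.norm_eq_abs]
      refine (mul_le_of_le_one_left (norm_nonneg _) hc).trans ((norm_sum_le _ _).trans
        (Finset.sum_le_sum fun y _ => ?_))
      rw [norm_mul, Complex.norm_real, Real.norm_eq_abs, abs_of_nonneg (by positivity)]
    calc _ ≤ _ := mul_le_mul_of_nonneg_left this hx.le
      _ = _ := by
        rw [mul_add, Finset.mul_sum]
        congr 1
        refine Finset.sum_congr rfl fun y _ => ?_
        field_simp
  have h2 : (∑ y ∈ G.neighborFinset x, Real.sqrt (w y) * ‖f y‖) ^ 2 ≤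
      (q + 1) * ∑ y ∈ G.neighborFinset x, w y * ‖f y‖ ^ 2 := by
    refine sq_sum_le_card_mul_sum_sq.trans (le_of_eq ?_)
    rw [G.card_neighborFinset_eq_degree, hG.degree_eq]
    push_cast
    congr 1
    refine Finset.sum_congr rfl fun y _ => ?_
    rw [mul_pow, Real.sq_sqrt (hwp y).le]
  have h3 : w x * ‖flowLaplacianFun G q o ω f x‖ ^ 2 =
      (Real.sqrt (w x) * ‖flowLaplacianFun G q o ω f x‖) ^ 2 := by
    rw [mul_pow, Real.sq_sqrt (hwp x).le]
  have h4 : w x * ‖f x‖ ^ 2 = (Real.sqrt (w x) * ‖f x‖) ^ 2 := by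
    rw [mul_pow, Real.sq_sqrt (hwp x).le]
  have h5 := pow_le_pow_left₀ (by positivity) h1 2
  have hq0 : (0 : ℝ) ≤ q := Nat.cast_nonneg q
  rw [h3, h4]
  push_cast
  nlinarith [sq_nonneg (Real.sqrt (w x) * ‖f x‖ -
    ∑ y ∈ G.neighborFinset x, Real.sqrt (w y) * ‖f y‖),
    mul_nonneg hq0 (sq_nonneg (Real.sqrt (w x) * ‖f x‖))]

theorem horizontalGradientFun_locallyBounded (hG : IsHomogeneousTree G q) {ε : V → ℂ}
    (hε : ∃ M : ℝ, ∀ x, ‖ε x‖ ≤ M) :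
    LocallyBounded G q o ω (horizontalGradientFun G q o ω ε) := by
  obtain ⟨M, hM⟩ := hε
  have hq : (0 : ℝ) < q := by exact_mod_cast (by have := hG.two_le; omega : 0 < q)
  refine ⟨⟨q * (M ^ 2 * (q + 1)), by positivity⟩, fun f x => ?_⟩
  set w := weight G q o ω with hw
  have hwp : ∀ x, 0 < w x := fun x => weight_pos hG x
  have hsub : succs G o ω x ⊆ G.neighborFinset x := Finset.filter_subset _ _
  have hwy : ∀ y ∈ succs G o ω x, w x = q * w y := by
    intro y hy
    have : level G o ω x = level G o ω y + 1 := by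
      have := (Finset.mem_filter.1 hy).2; omega
    simp only [hw, weight, this]
    rw [zpow_add₀ hq.ne', zpow_one, mul_comm]
  have h1 : ‖horizontalGradientFun G q o ω ε f x‖ ≤ ∑ y ∈ succs G o ω x, M * ‖f y‖ := by
    change ‖(1 / (q : ℂ)) * ∑ y ∈ succs G o ω x, ε y * f y‖ ≤ _
    rw [norm_mul]
    have hc : ‖(1 / (q : ℂ))‖ ≤ 1 := by
      rw [norm_div, norm_one, Complex.norm_natCast, div_le_one hq]
      exact_mod_cast (by have := hG.two_le; omega : 1 ≤ q)
    refine (mul_le_of_le_one_left (norm_nonneg _) hc).trans ((norm_sum_le _ _).trans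
        (Finset.sum_le_sum fun y _ => ?_))
    rw [norm_mul]
    exact mul_le_mul_of_nonneg_right (hM y) (norm_nonneg _)
  have hcard : ((succs G o ω x).card : ℝ) ≤ q + 1 := by
    have := Finset.card_le_card hsub
    rw [G.card_neighborFinset_eq_degree, hG.degree_eq] at this
    exact_mod_cast this
  calc w x * ‖horizontalGradientFun G q o ω ε f x‖ ^ 2
      ≤ w x * ((succs G o ω x).card * ∑ y ∈ succs G o ω x, (M * ‖f y‖) ^ 2) :=
        mul_le_mul_of_nonneg_left ((pow_le_pow_left₀ (norm_nonneg _) h1 2).trans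
          sq_sum_le_card_mul_sum_sq) (hwp x).le
    _ ≤ w x * ((q + 1) * ∑ y ∈ succs G o ω x, (M * ‖f y‖) ^ 2) := by
        have := hwp x
        gcongr
    _ = q * (M ^ 2 * (q + 1)) * ∑ y ∈ succs G o ω x, w y * ‖f y‖ ^ 2 := by
        rw [Finset.mul_sum, Finset.mul_sum, Finset.mul_sum]
        refine Finset.sum_congr rfl fun y hy => ?_
        rw [hwy y hy]; ring
    _ ≤ q * (M ^ 2 * (q + 1)) * (w x * ‖f x‖ ^ 2 +
          ∑ y ∈ G.neighborFinset x, w y * ‖f y‖ ^ 2) := by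
        refine mul_le_mul_of_nonneg_left ?_ (by positivity)
        have h2 : ∑ y ∈ succs G o ω x, w y * ‖f y‖ ^ 2 ≤
            ∑ y ∈ G.neighborFinset x, w y * ‖f y‖ ^ 2 :=
          Finset.sum_le_sum_of_subset_of_nonneg hsub fun y _ _ =>
            mul_nonneg (hwp y).le (sq_nonneg _)
        have h3 : 0 ≤ w x * ‖f x‖ ^ 2 := mul_nonneg (hwp x).le (sq_nonneg _)
        linarith

variable [MeasurableSpace V] [DiscreteMeasurableSpace V]

theorem ae_flowMeasure_iff (hG : IsHomogeneousTree G q) {P : V → Prop} :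
    (∀ᵐ x ∂(flowMeasure G q o ω), P x) ↔ ∀ x, P x := by
  refine ⟨fun h x => ?_, fun h => Filter.Eventually.of_forall h⟩
  rw [flowMeasure, Measure.ae_sum_iff' (.of_discrete)] at h
  have hx := h x
  rw [ae_iff, Measure.smul_apply, smul_eq_mul, mul_eq_zero] at hx
  rcases hx with hx | hx
  · exact absurd (ENNReal.ofReal_eq_zero.1 hx) (not_le.2 (weight_pos hG x))
  · rw [Measure.dirac_apply' _ (.of_discrete)] at hx
    by_contra hP
    simp [hP] at hx

theorem eLpNorm_le_of_locallyBounded (hG : IsHomogeneousTree G q)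
    {A : (V → ℂ) →ₗ[ℂ] (V → ℂ)} (hA : LocallyBounded G q o ω A) :
    ∃ C : ℝ≥0, ∀ f, eLpNorm (A f) 2 (flowMeasure G q o ω) ≤
      C * eLpNorm f 2 (flowMeasure G q o ω) := by
  obtain ⟨K, hK⟩ := hA
  refine ⟨NNReal.sqrt (K * (q + 2)), fun f => ?_⟩
  set w := weight G q o ω with hw
  have hwp : ∀ x, 0 < w x := fun x => weight_pos hG x
  have hsq : ∀ (g : V → ℂ), eLpNorm g 2 (flowMeasure G q o ω) =
      (∑' x, ENNReal.ofReal (w x * ‖g x‖ ^ 2)) ^ (1 / 2 : ℝ) := by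
    intro g
    rw [eLpNorm_eq_lintegral_rpow_enorm_toReal (by norm_num) (by norm_num),
      lintegral_flowMeasure]
    congr 1
    refine tsum_congr fun x => ?_
    rw [ENNReal.ofReal_mul (hwp x).le, ENNReal.ofReal_pow (norm_nonneg _), ofReal_norm]
    norm_num [hw]
  have key : ∑' x, ENNReal.ofReal (w x * ‖A f x‖ ^ 2) ≤
      (K * (q + 2) : ℝ≥0) * ∑' x, ENNReal.ofReal (w x * ‖f x‖ ^ 2) := by
    set a : V → ℝ≥0∞ := fun x => ENNReal.ofReal (w x * ‖f x‖ ^ 2) with ha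
    have hcount : ∑' x, ∑ y ∈ G.neighborFinset x, a y = ∑' y, (q + 1 : ℝ≥0∞) * a y := by
      classical
      have e1 : ∀ x, ∑ y ∈ G.neighborFinset x, a y = ∑' y, if G.Adj x y then a y else 0 := by
        intro x
        rw [tsum_eq_sum (s := G.neighborFinset x)]
        · exact Finset.sum_congr rfl fun y hy => by simp_all
        · intro y hy; simp_all
      simp_rw [e1]
      rw [ENNReal.tsum_comm]
      refine tsum_congr fun y => ?_
      rw [tsum_eq_sum (s := G.neighborFinset y)]
      · rw [Finset.sum_congr rfl (g := fun _ => a y)]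
        · rw [Finset.sum_const, G.card_neighborFinset_eq_degree, hG.degree_eq]
          simp
        · intro x hx
          rw [SimpleGraph.mem_neighborFinset] at hx
          simp [hx.symm]
      · intro x hx
        rw [SimpleGraph.mem_neighborFinset] at hx
        rw [if_neg fun h => hx h.symm]
    calc ∑' x, ENNReal.ofReal (w x * ‖A f x‖ ^ 2)
        ≤ ∑' x, (K : ℝ≥0∞) * (a x + ∑ y ∈ G.neighborFinset x, a y) := by
          refine ENNReal.tsum_le_tsum fun x => ?_
          have hn : ∀ y, 0 ≤ w y * ‖f y‖ ^ 2 := fun y =>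
            mul_nonneg (hwp y).le (sq_nonneg _)
          refine (ENNReal.ofReal_le_ofReal (hK f x)).trans (le_of_eq ?_)
          rw [ENNReal.ofReal_mul (NNReal.coe_nonneg K), ENNReal.ofReal_add (hn x)
            (Finset.sum_nonneg fun y _ => hn y),
            ENNReal.ofReal_sum_of_nonneg fun y _ => hn y, ENNReal.ofReal_coe_nnreal]
      _ = (K * (q + 2) : ℝ≥0) * ∑' x, a x := by
          rw [ENNReal.tsum_mul_left, ENNReal.tsum_add, hcount, ENNReal.tsum_mul_left]
          push_cast
          ring
  rw [hsq, hsq]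
  refine (ENNReal.rpow_le_rpow key (by norm_num)).trans (le_of_eq ?_)
  rw [ENNReal.mul_rpow_of_nonneg _ _ (by norm_num)]
  congr 1
  rw [NNReal.sqrt_eq_rpow, ENNReal.coe_rpow_of_nonneg _ (by norm_num)]

/-- The bounded operator on `L²(μ)` which sends (the class of) `f` to (the class of) `A f`. -/
def l2Operator (hG : IsHomogeneousTree G q) (A : (V → ℂ) →ₗ[ℂ] (V → ℂ))
    (hA : LocallyBounded G q o ω A) :
    Lp ℂ 2 (flowMeasure G q o ω) →L[ℂ] Lp ℂ 2 (flowMeasure G q o ω) :=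
  have hmem : ∀ f : Lp ℂ 2 (flowMeasure G q o ω), MemLp (A f) 2 (flowMeasure G q o ω) :=
    fun f => by
      obtain ⟨C, hC⟩ := eLpNorm_le_of_locallyBounded hG hA
      exact ⟨Measurable.of_discrete.aestronglyMeasurable, (hC f).trans_lt
        (ENNReal.mul_lt_top ENNReal.coe_lt_top (Lp.memLp f).2)⟩
  LinearMap.mkContinuousOfExistsBound
    { toFun := fun f => (hmem f).toLp (A f)
      map_add' := fun f g => by
        have h : ⇑(f + g) = ⇑f + ⇑g := funext ((ae_flowMeasure_iff hG).1 (Lp.coeFn_add f g))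
        rw [← MemLp.toLp_add, MemLp.toLp_eq_toLp_iff, h, map_add]
      map_smul' := fun c f => by
        have h : ⇑(c • f) = c • ⇑f := funext ((ae_flowMeasure_iff hG).1 (Lp.coeFn_smul c f))
        rw [RingHom.id_apply, ← MemLp.toLp_const_smul, MemLp.toLp_eq_toLp_iff, h, map_smul] }
    (by
      obtain ⟨C, hC⟩ := eLpNorm_le_of_locallyBounded hG hA
      refine ⟨C, fun f => ?_⟩
      change ‖(hmem f).toLp (A f)‖ ≤ _
      rw [Lp.norm_toLp, Lp.norm_def, ← ENNReal.coe_toReal, ← ENNReal.toReal_mul]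
      exact ENNReal.toReal_mono (ENNReal.mul_ne_top ENNReal.coe_ne_top (Lp.memLp f).2.ne) (hC f))

end Bounds

section Operators

/-- The nonnegative square root of a nonnegative bounded operator on a complex Hilbert space, by
the continuous functional calculus. -/
def operatorSqrt {E : Type*} [NormedAddCommGroup E] [InnerProductSpace ℂ E] [CompleteSpace E]
    (A : E →L[ℂ] E) : E →L[ℂ] E :=
  CFC.sqrt A

variable [MeasurableSpace V] [DiscreteMeasurableSpace V]
variable {G : SimpleGraph V} [G.LocallyFinite] {q : ℕ}

/-- The flow Laplacian `𝓛` as a bounded operator on `L²(μ)`. -/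
def flowLaplacian (hG : IsHomogeneousTree G q) (o : V) (ω : ℕ → V) :
    Lp ℂ 2 (flowMeasure G q o ω) →L[ℂ] Lp ℂ 2 (flowMeasure G q o ω) :=
  l2Operator hG (flowLaplacianFun G q o ω) (flowLaplacianFun_locallyBounded hG)

/-- The horizontal gradient `∇_ε` as a bounded operator on `L²(μ)`. -/
def horizontalGradient (hG : IsHomogeneousTree G q) (o : V) (ω : ℕ → V) (ε : V → ℂ)
    (hε : ∃ M : ℝ, ∀ x, ‖ε x‖ ≤ M) :
    Lp ℂ 2 (flowMeasure G q o ω) →L[ℂ] Lp ℂ 2 (flowMeasure G q o ω) :=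
  l2Operator hG (horizontalGradientFun G q o ω ε) (horizontalGradientFun_locallyBounded hG hε)

/-- The square root `𝓛^{1/2}` of the nonnegative bounded operator `𝓛`. -/
def sqrtLaplacian (hG : IsHomogeneousTree G q) (o : V) (ω : ℕ → V) :
    Lp ℂ 2 (flowMeasure G q o ω) →L[ℂ] Lp ℂ 2 (flowMeasure G q o ω) :=
  operatorSqrt (flowLaplacian hG o ω)

/-- The (unbounded) operator `𝓛^{-1/2}`: the inverse of the injective operator `𝓛^{1/2}`, with
domain the range of `𝓛^{1/2}`. -/
def invSqrtLaplacian (hG : IsHomogeneousTree G q) (o : V) (ω : ℕ → V) :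
    Lp ℂ 2 (flowMeasure G q o ω) →ₗ.[ℂ] Lp ℂ 2 (flowMeasure G q o ω) :=
  ((sqrtLaplacian hG o ω).toPMap ⊤).inverse

/-- The horizontal Riesz transform `R_ε = ∇_ε 𝓛^{-1/2}`, with domain that of `𝓛^{-1/2}`. -/
def horizontalRiesz (hG : IsHomogeneousTree G q) (o : V) (ω : ℕ → V) (ε : V → ℂ)
    (hε : ∃ M : ℝ, ∀ x, ‖ε x‖ ≤ M) :
    Lp ℂ 2 (flowMeasure G q o ω) →ₗ.[ℂ] Lp ℂ 2 (flowMeasure G q o ω) :=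
  (horizontalGradient hG o ω ε hε : _ →ₗ[ℂ] _).compPMap (invSqrtLaplacian hG o ω)

end Operators

/-- Weak type `(1,1)` of an operator `T` on `L²(μ)`: its restriction to `L¹ ∩ L²` extends to a
linear operator `S` from `L¹(μ)` to classes of measurable functions, such that
`μ {|S f| > t} ≤ C ‖f‖₁ / t` for all `f` in `L¹(μ)` and `t > 0`. -/
def IsWeakTypeOneOne [MeasurableSpace V] {μ : Measure V}
    (T : Lp ℂ 2 μ →ₗ.[ℂ] Lp ℂ 2 μ) : Prop :=
  ∃ (S : Lp ℂ 1 μ →ₗ[ℂ] (V →ₘ[μ] ℂ)) (C : ℝ≥0),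
    (∀ (f : Lp ℂ 1 μ) (g : T.domain), ⇑f =ᵐ[μ] ⇑(g : Lp ℂ 2 μ) → ⇑(S f) =ᵐ[μ] ⇑(T g)) ∧
    ∀ (f : Lp ℂ 1 μ) (t : ℝ), 0 < t →
      μ {x | t < ‖S f x‖} ≤ ENNReal.ofReal (C * ‖f‖ / t)

end FlowTree

end

namespace FlowTree

open ContinuousLinearMap (adjoint)
open Filter Topology

/-! Let `p` send each vertex to its neighbour one level up. Each fibre of `p` is some `s(x)`, with
`q` points of mass `μ(x)/q`, so `p` preserves `μ` and `V f = f ∘ p` is an isometry of `L²(μ)`. Then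
`𝓛 = 1 - (V + V†)/2` and `∇_ε† g = conj ε · (g ∘ p)`. The zero-sum condition gives `∇_ε V = 0`,
hence `V† ∇_ε† = 0`: the range of `∇_ε†` lies in the wandering subspace `ker V†`, whose images under
the powers `V ^ n` are mutually orthogonal.

For `w` in `ker V†`, `U_n(1 - 𝓛) w = V ^ n w` with `U_n` the Chebyshev polynomials of the second
kind. The Chebyshev expansion of `√(1 - y)`, that is, the Fourier series of `|sin|`, therefore
yields `𝓛^{-1/2} w = ∑ c_n V ^ n w` with explicit `c_n = O(1/n)`; orthogonality makes this converge
for every such `w`. So the adjoint is everywhere defined, with value `∑ c_n conj ε(p^n x) g(p^{n+1}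
x)` at `x` (`sqrt_shiftLaplacian_apply`, `hasSum_adjoint_horizontalRiesz_apply`).

For `f` in `L¹` and height `t`, cut `f` in the `n`-th term at `t(n+1)`. The set where some cut
matters has measure at most `∑ μ{|f| ≥ t(n+1)} ≤ ‖f‖₁/t`. The terms that remain are orthogonal in
`L²`, and `c_n ≤ 2/(n+1)` bounds the square of their sum by a multiple of `t‖f‖₁`, so Chebyshev's
inequality concludes. The bound is uniform over partial sums and passes to the limit. -/

/-! ### Chebyshev expansion of the square root. -/

theorem periodic_abs_sin : Function.Periodic (fun x : ℝ => ((|Real.sin x| : ℝ) : ℂ)) Real.pi := by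
  intro x
  simp [Real.sin_add_pi]

theorem four_mul_sq_sub_one_ne_zero (n : ℤ) : (1 - 4 * (n : ℂ) ^ 2) ≠ 0 := by
  have : (1 - 4 * n ^ 2 : ℤ) ≠ 0 := by omega
  exact_mod_cast this

theorem integral_exp_mul_sin (n : ℤ) :
    ∫ x in (0 : ℝ)..Real.pi, Complex.exp (-(2 * n * Complex.I) * x) * (Real.sin x : ℂ) =
      2 / (1 - 4 * (n : ℂ) ^ 2) := by
  set c : ℂ := -(2 * n * Complex.I) with hc
  have hc2 : c ^ 2 + 1 = 1 - 4 * (n : ℂ) ^ 2 := by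
    rw [hc]; ring_nf; simp; ring
  have hne : c ^ 2 + 1 ≠ 0 := hc2 ▸ four_mul_sq_sub_one_ne_zero n
  have hder : ∀ x ∈ Set.uIcc (0 : ℝ) Real.pi, HasDerivAt
      (fun x : ℝ => Complex.exp (c * x) * (c * (Real.sin x : ℂ) - (Real.cos x : ℂ)) / (c ^ 2 + 1))
      (Complex.exp (c * x) * (Real.sin x : ℂ)) x := by
    intro x _
    have h1 : HasDerivAt (fun x : ℝ => Complex.exp (c * x)) (Complex.exp (c * x) * (c * 1)) x :=
      ((Complex.ofRealCLM.hasDerivAt (x := x)).const_mul c).cexp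
    have h2 := (Real.hasDerivAt_sin x).ofReal_comp
    have h3 := (Real.hasDerivAt_cos x).ofReal_comp
    refine ((h1.mul ((h2.const_mul c).sub h3)).div_const (c ^ 2 + 1)).congr_deriv ?_
    rw [div_eq_iff hne]
    simp only [Pi.sub_apply]
    push_cast
    ring
  rw [intervalIntegral.integral_eq_sub_of_hasDerivAt hder
    (Continuous.intervalIntegrable (by fun_prop) _ _)]
  have : Complex.exp (c * Real.pi) = 1 := by
    rw [Complex.exp_eq_one_iff]
    exact ⟨-n, by rw [hc]; push_cast; ring⟩
  simp only [this, Real.sin_pi, Real.cos_pi, Real.sin_zero, Real.cos_zero, hc2]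
  push_cast
  simp
  ring

/-- Fourier series of the `π`-periodic function `|sin|`, whose coefficients `O(1/n²)` are summable.
Folding `n` with `-n` counts the zeroth coefficient `2/π` twice, hence the extra term on the right.
-/
theorem hasSum_sin (θ : ℝ) (h0 : 0 ≤ θ) (h1 : θ ≤ Real.pi) :
    HasSum (fun n : ℕ => 4 / Real.pi / (1 - 4 * (n : ℝ) ^ 2) * Real.cos (n * (2 * θ)))
      (Real.sin θ + 2 / Real.pi) := by
  have : Fact (0 < Real.pi) := ⟨Real.pi_pos⟩
  let f : C(AddCircle Real.pi, ℂ) := ⟨periodic_abs_sin.lift,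
    continuous_coinduced_dom.mpr (by
      change Continuous fun x : ℝ => ((|Real.sin x| : ℝ) : ℂ)
      fun_prop)⟩
  have hf : ∀ x : ℝ, f x = ((|Real.sin x| : ℝ) : ℂ) := fun x => rfl
  have hcoe : ∀ n : ℤ, fourierCoeff f n = 2 / Real.pi / (1 - 4 * (n : ℂ) ^ 2) := by
    intro n
    rw [fourierCoeff_eq_intervalIntegral f n 0, zero_add]
    have : ∫ x in (0 : ℝ)..Real.pi, fourier (-n) (x : AddCircle Real.pi) • f x =
        ∫ x in (0 : ℝ)..Real.pi, Complex.exp (-(2 * n * Complex.I) * x) * (Real.sin x : ℂ) := by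
      refine intervalIntegral.integral_congr fun x hx => ?_
      rw [Set.uIcc_of_le Real.pi_pos.le] at hx
      have hpi : (Real.pi : ℂ) ≠ 0 := by exact_mod_cast Real.pi_ne_zero
      simp only [hf, fourier_coe_apply, smul_eq_mul]
      rw [abs_of_nonneg (Real.sin_nonneg_of_mem_Icc hx)]
      congr 2
      push_cast
      field_simp
    rw [this, integral_exp_mul_sin]
    rw [Complex.real_smul]
    push_cast
    field_simp
  have hsumm : Summable (fourierCoeff f) := by
    have hb : Summable fun n : ℤ => 2 * ((1 : ℝ) / (n : ℝ) ^ 2) :=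
      (Real.summable_one_div_int_pow.2 one_lt_two).mul_left _
    refine hb.of_norm_bounded_eventually ?_
    filter_upwards [Filter.eventually_cofinite_ne (0 : ℤ)] with n hn
    rw [hcoe]
    have h4 : (1 : ℝ) ≤ (n : ℝ) ^ 2 := by
      have : (0 : ℤ) < n ^ 2 := by positivity
      have : (1 : ℤ) ≤ n ^ 2 := this
      exact_mod_cast this
    have h5 : ‖(1 - 4 * (n : ℂ) ^ 2)‖ = 4 * (n : ℝ) ^ 2 - 1 := by
      rw [show (1 - 4 * (n : ℂ) ^ 2) = ((1 - 4 * (n : ℝ) ^ 2 : ℝ) : ℂ) by push_cast; rfl,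
        Complex.norm_real, Real.norm_eq_abs, abs_of_neg (by linarith)]
      ring
    have h6 : ‖(2 / Real.pi : ℂ)‖ ≤ 1 := by
      rw [show (2 / Real.pi : ℂ) = ((2 / Real.pi : ℝ) : ℂ) by push_cast; rfl,
        Complex.norm_real, Real.norm_eq_abs, abs_of_pos (by positivity),
        div_le_one Real.pi_pos]
      exact Real.two_le_pi
    rw [norm_div, h5]
    calc _ ≤ 1 / (4 * (n : ℝ) ^ 2 - 1) := by gcongr; linarith
      _ ≤ 2 * (1 / (n : ℝ) ^ 2) := by
        rw [mul_one_div, div_le_div_iff₀ (by linarith) (by linarith)]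
        linarith
  have h := (has_pointwise_sum_fourier_series_of_summable hsumm (θ : AddCircle Real.pi)).nat_add_neg
  rw [hf, abs_of_nonneg (Real.sin_nonneg_of_mem_Icc ⟨h0, h1⟩)] at h
  rw [← Complex.hasSum_ofReal]
  convert h using 1
  · ext n
    have hpi : (Real.pi : ℂ) ≠ 0 := by exact_mod_cast Real.pi_ne_zero
    simp only [hcoe, fourier_coe_apply, smul_eq_mul]
    have e1 : 2 * Real.pi * Complex.I * ((n : ℤ) : ℂ) * θ / Real.pi =
        (n * (2 * θ) : ℂ) * Complex.I := by
      push_cast; field_simp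
    have e2 : 2 * Real.pi * Complex.I * ((-(n : ℤ) : ℤ) : ℂ) * θ / Real.pi =
        -(n * (2 * θ) : ℂ) * Complex.I := by
      push_cast; field_simp
    rw [e1, e2]
    push_cast
    rw [Complex.cos]
    ring
  · simp [hcoe]

/-- The coefficients of the Chebyshev expansion of `√(1 - x)`. -/
noncomputable def sqrtCoeff (n : ℕ) : ℝ := 4 * √2 / Real.pi / (1 - 4 * (n : ℝ) ^ 2)

/-- Partial sums of the Chebyshev expansion of the square root, as a function of `1 - x`. -/
noncomputable def sqrtPoly (N : ℕ) : Polynomial ℝ :=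
  (∑ n ∈ Finset.range N, sqrtCoeff n • Polynomial.Chebyshev.T ℝ n) -
    Polynomial.C (2 * √2 / Real.pi)

/-- Substitute `1 - x = cos 2θ`: then `√x = √2 sin θ` and `T_n(1 - x) = cos 2nθ`, so this is the
sine series again. -/
theorem hasSum_sqrt {x : ℝ} (hx : x ∈ Set.Icc (0 : ℝ) 2) :
    HasSum (fun n : ℕ => sqrtCoeff n * (Polynomial.Chebyshev.T ℝ n).eval (1 - x))
      (√x + 2 * √2 / Real.pi) := by
  have hcos : Real.cos (Real.arccos (1 - x)) = 1 - x :=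
    Real.cos_arccos (by linarith [hx.2]) (by linarith [hx.1])
  set θ := Real.arccos (1 - x) / 2 with hθ
  have h0 : 0 ≤ θ := by have := Real.arccos_nonneg (1 - x); positivity
  have h1 : θ ≤ Real.pi := by
    have := Real.arccos_le_pi (1 - x); have := Real.pi_pos; linarith
  have h2 : Real.arccos (1 - x) = 2 * θ := by rw [hθ]; ring
  rw [h2] at hcos
  have hs : √x = √2 * Real.sin θ := by
    have : x = 2 * Real.sin θ ^ 2 := by
      rw [Real.cos_two_mul] at hcos
      have := Real.sin_sq_add_cos_sq θ
      linarith
    rw [this, Real.sqrt_mul (by norm_num),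
      Real.sqrt_sq (Real.sin_nonneg_of_mem_Icc ⟨h0, h1⟩)]
  have h := (hasSum_sin θ h0 h1).mul_left √2
  rw [show √x + 2 * √2 / Real.pi = √2 * (Real.sin θ + 2 / Real.pi) by rw [hs]; ring]
  convert! h using 2 with n
  rw [← hcos, Polynomial.Chebyshev.T_real_cos, sqrtCoeff]
  push_cast
  ring

/-- At `x = 0` every `T_n(1)` is `1`, and unconditional summability of reals is absolute. -/
theorem summable_abs_sqrtCoeff : Summable fun n => |sqrtCoeff n| := by
  have := (hasSum_sqrt (x := 0) (by simp)).summable.abs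
  simpa using this

/-- Weierstrass test, as `|T_n| ≤ 1` on `[-1, 1]`. -/
theorem tendstoUniformlyOn_sqrtPoly :
    TendstoUniformlyOn (fun N x => (sqrtPoly N).eval (1 - x)) Real.sqrt Filter.atTop
      (Set.Icc 0 2) := by
  have h := tendstoUniformlyOn_tsum_nat summable_abs_sqrtCoeff (s := Set.Icc (0 : ℝ) 2)
    (f := fun n x => sqrtCoeff n * (Polynomial.Chebyshev.T ℝ n).eval (1 - x)) (by
      intro n x hx
      rw [norm_mul, Real.norm_eq_abs, Real.norm_eq_abs]
      refine mul_le_of_le_one_right (abs_nonneg _) ?_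
      rw [← Real.cos_arccos (x := 1 - x) (by linarith [hx.2]) (by linarith [hx.1]),
        Polynomial.Chebyshev.T_real_cos]
      exact Real.abs_cos_le_one _)
  have h2 : TendstoUniformlyOn (fun (_ : ℕ) (_ : ℝ) => 2 * √2 / Real.pi)
      (fun _ => 2 * √2 / Real.pi) Filter.atTop (Set.Icc 0 2) :=
    fun _ hu => Filter.Eventually.of_forall fun _ _ _ => refl_mem_uniformity hu
  refine ((h.sub h2).congr ?_).congr_right ?_
  · refine Filter.Eventually.of_forall fun N x _ => ?_
    simp [sqrtPoly, Polynomial.eval_finsetSum]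
  · intro x hx
    simp [(hasSum_sqrt hx).tsum_eq]

theorem isometry_pow_succ_apply {H : Type*} [NormedAddCommGroup H] [InnerProductSpace ℂ H]
    (V : H →ₗᵢ[ℂ] H) (n : ℕ) (u : H) : (V ^ (n + 1)) u = V ((V ^ n) u) := by
  rw [pow_succ']; rfl

/-! ### Inverse square root of `1 - (V + V†)/2` on the wandering subspace of an isometry. -/

section Shift

variable {H : Type*} [NormedAddCommGroup H] [InnerProductSpace ℂ H] [CompleteSpace H]

/-- The operator `1 - (V + V†) / 2` attached to an isometry `V`. -/
noncomputable def shiftLaplacian (V : H →ₗᵢ[ℂ] H) : H →L[ℂ] H :=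
  1 - (1 / 2 : ℝ) • (V.toContinuousLinearMap + adjoint V.toContinuousLinearMap)

variable (V : H →ₗᵢ[ℂ] H)

theorem shiftLaplacian_apply (u : H) : shiftLaplacian V u =
    u - (1 / 2 : ℝ) • (V u + adjoint V.toContinuousLinearMap u) := rfl

theorem shiftLaplacian_apply_complex (u : H) : shiftLaplacian V u =
    u - (1 / 2 : ℂ) • (V u + adjoint V.toContinuousLinearMap u) := by
  rw [shiftLaplacian_apply, ← Complex.coe_smul]
  norm_num

theorem adjoint_isometry_apply (u : H) : adjoint V.toContinuousLinearMap (V u) = u := by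
  refine ext_inner_left ℂ fun v => ?_
  rw [ContinuousLinearMap.adjoint_inner_right]
  exact V.inner_map_map v u

theorem isSelfAdjoint_shiftLaplacian : IsSelfAdjoint (shiftLaplacian V) := by
  refine (IsSelfAdjoint.one _).sub (IsSelfAdjoint.smul (.all _) ?_)
  rw [← ContinuousLinearMap.star_eq_adjoint]
  exact IsSelfAdjoint.add_star_self _

/-- This identity gives both positivity and injectivity: the kernel consists of fixed vectors of
`V`. -/
theorem re_inner_shiftLaplacian (u : H) :
    RCLike.re (inner ℂ (shiftLaplacian V u) u) = ‖V u - u‖ ^ 2 / 2 := by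
  have h1 : RCLike.re (inner ℂ (adjoint V.toContinuousLinearMap u) u) =
      RCLike.re (inner ℂ (V u) u) := by
    rw [ContinuousLinearMap.adjoint_inner_left, inner_re_symm]
    rfl
  rw [norm_sub_sq (𝕜 := ℂ), V.norm_map, shiftLaplacian_apply, inner_sub_left,
    ← Complex.coe_smul, inner_smul_left, inner_add_left, map_sub, Complex.conj_ofReal]
  have h2 : RCLike.re (((1 / 2 : ℝ) : ℂ) * (inner ℂ (V u) u +
      inner ℂ (adjoint V.toContinuousLinearMap u) u)) =
      1 / 2 * (RCLike.re (inner ℂ (V u) u) +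
        RCLike.re (inner ℂ (adjoint V.toContinuousLinearMap u) u)) := by
    rw [← map_add]
    exact Complex.re_ofReal_mul _ _
  rw [h2, h1, inner_self_eq_norm_sq]
  ring

theorem shiftLaplacian_nonneg : 0 ≤ shiftLaplacian V := by
  rw [ContinuousLinearMap.nonneg_iff_isPositive]
  refine ContinuousLinearMap.isPositive_def'.2 ⟨isSelfAdjoint_shiftLaplacian V, fun u => ?_⟩
  rw [ContinuousLinearMap.reApplyInnerSelf_apply, re_inner_shiftLaplacian]
  positivity

theorem norm_shiftLaplacian_le : ‖shiftLaplacian V‖ ≤ 2 := by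
  refine ContinuousLinearMap.opNorm_le_bound _ (by norm_num) fun u => ?_
  have h : ‖adjoint V.toContinuousLinearMap u‖ ≤ ‖u‖ := by
    refine ((adjoint V.toContinuousLinearMap).le_opNorm u).trans ?_
    rw [LinearIsometryEquiv.norm_map]
    exact mul_le_of_le_one_left (norm_nonneg _) V.norm_toContinuousLinearMap_le
  rw [shiftLaplacian_apply]
  refine (norm_sub_le _ _).trans ?_
  rw [norm_smul]
  have := (norm_add_le (V u) (adjoint V.toContinuousLinearMap u))
  rw [V.norm_map] at this
  norm_num
  linarith

theorem spectrum_shiftLaplacian_subset : spectrum ℝ (shiftLaplacian V) ⊆ Set.Icc 0 2 := by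
  intro x hx
  refine ⟨spectrum_nonneg_of_nonneg (shiftLaplacian_nonneg V) hx, (le_abs_self x).trans ?_⟩
  refine (spectrum.norm_le_norm_mul_of_mem hx).trans ?_
  calc _ ≤ ‖shiftLaplacian V‖ * 1 := by
        gcongr
        exact ContinuousLinearMap.norm_id_le
    _ ≤ 2 := by simpa using norm_shiftLaplacian_le V

theorem shiftLaplacian_injective (hV : ∀ u, V u = u → u = 0) {u : H}
    (hu : shiftLaplacian V u = 0) : u = 0 := by
  have h := re_inner_shiftLaplacian V u
  rw [hu, inner_zero_left, map_zero] at h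
  have h2 : ‖V u - u‖ ^ 2 = 0 := by linarith
  exact hV u (sub_eq_zero.1 (norm_eq_zero.1 (pow_eq_zero_iff two_ne_zero |>.1 h2)))

/-- The spectrum lies in `[0, 2]`, where the polynomials converge uniformly, so the functional
calculus gives convergence in operator norm. -/
theorem tendsto_aeval_sqrtPoly : Tendsto
    (fun N => Polynomial.aeval (1 - shiftLaplacian V) (sqrtPoly N)) atTop
    (𝓝 (CFC.sqrt (shiftLaplacian V))) := by
  have hsa := isSelfAdjoint_shiftLaplacian V
  rw [CFC.sqrt_eq_real_sqrt _ (shiftLaplacian_nonneg V), cfcₙ_eq_cfc]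
  have h := tendsto_cfc_fun (a := shiftLaplacian V)
    (tendstoUniformlyOn_sqrtPoly.mono (spectrum_shiftLaplacian_subset V))
    (Eventually.of_forall fun N => Continuous.continuousOn (by fun_prop))
  refine h.congr fun N => ?_
  have e : (fun x : ℝ => (sqrtPoly N).eval (1 - x)) =
      fun x => ((sqrtPoly N).comp (1 - Polynomial.X)).eval x := by
    ext x; simp
  rw [e, cfc_polynomial _ _ hsa, Polynomial.aeval_comp]
  simp

/-- Since `V†V = 1`, `2(1 - 𝓛) V^{n+1} w = V^{n+2} w + V^n w`, the recurrence of the `U_n`. The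
condition `V† w = 0` supplies the initial value `2(1 - 𝓛) w = V w`. -/
theorem chebyshev_isometry {w : H} (hw : adjoint V.toContinuousLinearMap w = 0) (n : ℕ) :
    Polynomial.aeval (1 - shiftLaplacian V) (Polynomial.Chebyshev.U ℝ n) w = (V ^ n) w := by
  have hX : ∀ u, (1 - shiftLaplacian V) u =
      (1 / 2 : ℝ) • (V u + adjoint V.toContinuousLinearMap u) := fun u => by
    simp [shiftLaplacian]
  induction n using Nat.twoStepInduction with
  | zero => simp
  | one =>
    simp only [Nat.cast_one, Polynomial.Chebyshev.U_one, map_mul, Polynomial.aeval_X, map_ofNat,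
      mul_apply_eq_comp, hX, hw, add_zero, pow_one]
    rw [show (2 : H →L[ℂ] H) = (2 : ℝ) • 1 by ext; simp [two_smul, ofNat_smul_eq_nsmul]]
    simp [smul_smul]
  | more n h1 h2 =>
    have e : Polynomial.Chebyshev.U ℝ ((n + 2 : ℕ) : ℤ) =
        2 * Polynomial.X * Polynomial.Chebyshev.U ℝ ((n + 1 : ℕ) : ℤ) -
          Polynomial.Chebyshev.U ℝ n := by
      push_cast; exact Polynomial.Chebyshev.U_add_two ℝ n
    rw [e]
    simp only [map_sub, map_mul, Polynomial.aeval_X, map_ofNat,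
      mul_apply_eq_comp, sub_apply, h1, h2, hX]
    rw [show (2 : H →L[ℂ] H) = (2 : ℝ) • 1 by ext; simp [two_smul, ofNat_smul_eq_nsmul]]
    simp only [isometry_pow_succ_apply V, adjoint_isometry_apply]
    simp [smul_smul]

/-- The coefficients of `𝓛^{-1/2} ∇_ε†` in terms of the isometry of composition with the
parent map. -/
noncomputable def rieszCoeff (n : ℕ) : ℝ :=
  2 * √2 / Real.pi * (1 / (2 * n + 3) + 1 / (2 * n + 1))

theorem sqrtCoeff_succ (n : ℕ) : sqrtCoeff (n + 1) =
    2 * √2 / Real.pi * (1 / (2 * n + 3) - 1 / (2 * n + 1)) := by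
  have h1 : (2 * n + 3 : ℝ) ≠ 0 := by positivity
  have h2 : (2 * n + 1 : ℝ) ≠ 0 := by positivity
  have h3 : (1 - 4 * ((n + 1 : ℕ) : ℝ) ^ 2) = -((2 * n + 3) * (2 * n + 1)) := by
    push_cast; ring
  rw [sqrtCoeff, h3]
  field_simp
  ring

/-- Finite form of `√𝓛 w = 𝓛 ∑ c_n V^n w`. With `T_n = (U_n - U_{n-2})/2` both sides expand in the
vectors `V^n w`; the `c_n` are chosen so that all coefficients agree except two boundary ones of
size `O(1/N)`. -/
theorem aeval_sqrtPoly_sub {w : H} (hw : adjoint V.toContinuousLinearMap w = 0) (N : ℕ) :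
    Polynomial.aeval (1 - shiftLaplacian V) (sqrtPoly (N + 2)) w -
      shiftLaplacian V (∑ n ∈ Finset.range (N + 1), rieszCoeff n • (V ^ n) w) =
    (2 * √2 / Real.pi / (2 * N + 3)) • ((V ^ (N + 1)) w - (V ^ N) w) := by
  have hL : ∀ n, shiftLaplacian V ((V ^ (n + 1)) w) =
      (V ^ (n + 1)) w - (1 / 2 : ℝ) • ((V ^ (n + 2)) w + (V ^ n) w) := fun n => by
    rw [shiftLaplacian_apply]
    simp only [isometry_pow_succ_apply V, adjoint_isometry_apply]
  have hL0 : shiftLaplacian V w = w - (1 / 2 : ℝ) • V w := by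
    rw [shiftLaplacian_apply, hw, add_zero]
  have hT : ∀ n : ℕ, Polynomial.aeval (1 - shiftLaplacian V)
      (Polynomial.Chebyshev.T ℝ ((n + 2 : ℕ) : ℤ)) w =
      (1 / 2 : ℝ) • ((V ^ (n + 2)) w - (V ^ n) w) := fun n => by
    have e : Polynomial.Chebyshev.T ℝ ((n + 2 : ℕ) : ℤ) =
        (1 / 2 : ℝ) • (Polynomial.Chebyshev.U ℝ ((n + 2 : ℕ) : ℤ) -
          Polynomial.Chebyshev.U ℝ n) := by
      push_cast
      rw [← Polynomial.Chebyshev.two_mul_T_eq_U_sub_U, two_mul, ← two_smul ℝ, smul_smul]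
      norm_num
    rw [e, map_smul, map_sub, smul_apply, sub_apply,
      chebyshev_isometry V hw, chebyshev_isometry V hw]
  have hsucc : ∀ N, Polynomial.aeval (1 - shiftLaplacian V) (sqrtPoly (N + 1)) w =
      Polynomial.aeval (1 - shiftLaplacian V) (sqrtPoly N) w + sqrtCoeff N •
        Polynomial.aeval (1 - shiftLaplacian V) (Polynomial.Chebyshev.T ℝ N) w := fun N => by
    simp only [sqrtPoly, Finset.sum_range_succ, map_sub, map_add, map_smul]
    simp only [sub_apply, add_apply,
      smul_apply]
    abel
  induction N with
  | zero =>
    have hV1 : (V ^ (0 + 1)) w = V w := isometry_pow_succ_apply V 0 w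
    rw [hV1, hsucc 1, hsucc 0, Finset.sum_range_one,
      ContinuousLinearMap.map_smul_of_tower]
    simp only [sqrtPoly, Finset.range_zero, Finset.sum_empty, zero_sub, map_neg,
      Polynomial.aeval_C, pow_zero, one_apply_eq_self, hL0, Nat.cast_zero, Nat.cast_one,
      Polynomial.Chebyshev.T_zero, Polynomial.Chebyshev.T_one, map_one, Polynomial.aeval_X,
      sub_apply, neg_apply, Algebra.algebraMap_eq_smul_one, smul_apply, sqrtCoeff, rieszCoeff,
      LinearIsometry.coe_one, id_eq]
    match_scalars <;> field_simp <;> ring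
  | succ N ih =>
    rw [hsucc (N + 2), Finset.sum_range_succ, map_add, add_sub_add_comm, ih, hT,
      ContinuousLinearMap.map_smul_of_tower, hL, sqrtCoeff_succ, rieszCoeff]
    have h1 : (2 * (N : ℝ) + 3) ≠ 0 := by positivity
    have h2 : (2 * (N : ℝ) + 5) ≠ 0 := by positivity
    push_cast
    match_scalars <;> field_simp <;> ring

theorem sqrt_shiftLaplacian_sqrt_apply (u : H) : operatorSqrt (shiftLaplacian V)
    (operatorSqrt (shiftLaplacian V) u) = shiftLaplacian V u :=
  congrArg (fun B : H →L[ℂ] H => B u) (CFC.sqrt_mul_sqrt_self _ (shiftLaplacian_nonneg V))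

/-- In the limit the previous identity reads `√𝓛 w = 𝓛 h = √𝓛 √𝓛 h`, and a factor is cancelled by
injectivity. -/
theorem sqrt_shiftLaplacian_apply (hV : ∀ u, V u = u → u = 0) {w h : H}
    (hw : adjoint V.toContinuousLinearMap w = 0)
    (hh : HasSum (fun n => (rieszCoeff n : ℂ) • (V ^ n) w) h) :
    operatorSqrt (shiftLaplacian V) h = w := by
  simp only [Complex.coe_smul] at hh
  set A := operatorSqrt (shiftLaplacian V) with hA
  have hAA : ∀ u, A (A u) = shiftLaplacian V u := sqrt_shiftLaplacian_sqrt_apply V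
  have h1 : Tendsto (fun N => Polynomial.aeval (1 - shiftLaplacian V) (sqrtPoly (N + 2)) w) atTop
      (𝓝 (A w)) :=
    (((ContinuousLinearMap.apply ℂ H w).continuous.tendsto _).comp
      (tendsto_aeval_sqrtPoly V)).comp (tendsto_add_atTop_nat 2)
  have h2 : Tendsto (fun N => shiftLaplacian V
      (∑ n ∈ Finset.range (N + 1), rieszCoeff n • (V ^ n) w)) atTop (𝓝 (shiftLaplacian V h)) :=
    ((shiftLaplacian V).continuous.tendsto _).comp
      (hh.tendsto_sum_nat.comp (tendsto_add_atTop_nat 1))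
  -- The boundary remainder is a null sequence times vectors of norm at most `2‖w‖`.
  have h3 : Tendsto (fun N : ℕ => (2 * √2 / Real.pi / (2 * N + 3)) •
      ((V ^ (N + 1)) w - (V ^ N) w)) atTop (𝓝 0) := by
    have hlim : Tendsto (fun N : ℕ => 2 * √2 / Real.pi / (2 * (N : ℝ) + 3)) atTop (𝓝 0) :=
      tendsto_const_nhds.div_atTop (tendsto_atTop_add_const_right _ _
        (tendsto_natCast_atTop_atTop.const_mul_atTop two_pos))
    refine hlim.zero_smul_isBoundedUnder_le (isBoundedUnder_of ⟨‖w‖ + ‖w‖, fun N => ?_⟩)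
    refine (norm_sub_le _ _).trans (le_of_eq ?_)
    rw [LinearIsometry.norm_map, LinearIsometry.norm_map]
  have h4 : A w = shiftLaplacian V h := sub_eq_zero.1
    (tendsto_nhds_unique ((h1.sub h2).congr fun N => aeval_sqrtPoly_sub V hw N) h3)
  rw [← hAA] at h4
  have h5 : shiftLaplacian V (A h - w) = 0 := by
    rw [← hAA, map_sub, map_sub, h4, sub_self]
  exact sub_eq_zero.1 (shiftLaplacian_injective V hV h5)

theorem sqrt_shiftLaplacian_injective (hV : ∀ u, V u = u → u = 0) :
    Function.Injective (⇑(operatorSqrt (shiftLaplacian V))) := by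
  refine (injective_iff_map_eq_zero _).2 fun u hu => shiftLaplacian_injective V hV ?_
  rw [← sqrt_shiftLaplacian_sqrt_apply, hu, map_zero]

theorem adjoint_sqrt_shiftLaplacian :
    adjoint (operatorSqrt (shiftLaplacian V)) = operatorSqrt (shiftLaplacian V) :=
  (IsSelfAdjoint.of_nonneg (CFC.sqrt_nonneg (shiftLaplacian V))).adjoint_eq

/-- Wold's argument: cancel the common power of `V`, then move one remaining `V` across the inner
product, where `V†` kills the other vector. -/
theorem orthogonalFamily_pow : OrthogonalFamily ℂ
    (fun _ : ℕ => (adjoint V.toContinuousLinearMap).ker)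
    (fun n => (V ^ n).comp (adjoint V.toContinuousLinearMap).ker.subtypeₗᵢ) := by
  have hlt : ∀ m k : ℕ, ∀ u w : H, adjoint V.toContinuousLinearMap w = 0 →
      inner ℂ ((V ^ (m + (k + 1))) u) ((V ^ m) w) = 0 := by
    intro m k u w hw
    rw [pow_add]
    change inner ℂ ((V ^ m) ((V ^ (k + 1)) u)) ((V ^ m) w) = 0
    rw [LinearIsometry.inner_map_map, isometry_pow_succ_apply,
      ← V.coe_toContinuousLinearMap, ← ContinuousLinearMap.adjoint_inner_right, hw,
      inner_zero_right]
  intro n m hnm u w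
  rcases lt_or_gt_of_ne hnm with h | h
  · obtain ⟨k, rfl⟩ := Nat.exists_eq_add_of_lt h
    rw [← inner_conj_symm]
    exact (congrArg _ (hlt n k w u u.2)).trans (map_zero _)
  · obtain ⟨k, rfl⟩ := Nat.exists_eq_add_of_lt h
    exact hlt m k u w w.2

/-- The vector may change with `n`; the weak-type estimate needs this because it truncates
differently in each term. -/
theorem norm_sum_pow_sq {w : ℕ → H} (hw : ∀ n, adjoint V.toContinuousLinearMap (w n) = 0)
    (N : ℕ) : ‖∑ n ∈ Finset.range N, (V ^ n) (w n)‖ ^ 2 = ∑ n ∈ Finset.range N, ‖w n‖ ^ 2 :=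
  (orthogonalFamily_pow V).norm_sum (fun n => ⟨w n, hw n⟩) (Finset.range N)

theorem rieszCoeff_nonneg (n : ℕ) : 0 ≤ rieszCoeff n := by
  unfold rieszCoeff; positivity

theorem rieszCoeff_le (n : ℕ) : rieszCoeff n ≤ 2 / (n + 1) := by
  have h1 : 2 * √2 / Real.pi ≤ 1 := by
    rw [div_le_one Real.pi_pos]
    have : √2 ≤ 3 / 2 := Real.sqrt_le_iff.2 ⟨by norm_num, by norm_num⟩
    linarith [Real.pi_gt_three]
  have h2 : (1 / (2 * n + 3) + 1 / (2 * n + 1) : ℝ) ≤ 1 / (n + 1) + 1 / (n + 1) := by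
    gcongr <;> linarith [(Nat.cast_nonneg n : (0 : ℝ) ≤ n)]
  calc rieszCoeff n ≤ 1 * (1 / (n + 1) + 1 / (n + 1)) := by unfold rieszCoeff; gcongr
    _ = 2 / (n + 1) := by ring

/-- The coefficients are only of order `1/n`, so the series need not converge absolutely;
orthogonality reduces the matter to their squares. -/
theorem summable_rieszCoeff_smul {w : H} (hw : adjoint V.toContinuousLinearMap w = 0) :
    Summable fun n => (rieszCoeff n : ℂ) • (V ^ n) w := by
  simp only [Complex.coe_smul]
  have hc : Summable fun n => ‖rieszCoeff n • w‖ ^ 2 := by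
    have hs : Summable fun n : ℕ => 4 * ‖w‖ ^ 2 * (1 / ((n + 1 : ℕ) : ℝ) ^ 2) :=
      ((summable_nat_add_iff 1).2 (Real.summable_one_div_nat_pow.2 one_lt_two)).mul_left _
    refine hs.of_nonneg_of_le (fun n => sq_nonneg _) fun n => ?_
    rw [norm_smul, Real.norm_of_nonneg (rieszCoeff_nonneg n)]
    calc (rieszCoeff n * ‖w‖) ^ 2 ≤ (2 / (n + 1) * ‖w‖) ^ 2 := by
          have := rieszCoeff_nonneg n
          gcongr
          exact rieszCoeff_le n
      _ = _ := by push_cast; field_simp; ring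
  have h := ((orthogonalFamily_pow V).summable_iff_norm_sq_summable
    (fun n => ⟨rieszCoeff n • w, by
      rw [LinearMap.mem_ker]
      exact (ContinuousLinearMap.map_smul_of_tower _ _ _).trans (by rw [hw, smul_zero])⟩)).2 hc
  refine h.congr fun n => ?_
  exact (V ^ n).toContinuousLinearMap.map_smul_of_tower (rieszCoeff n) w

end Shift

/-! ### Levels, the parent map and invariance of the flow measure. -/

section Tree

variable {V : Type*} {G : SimpleGraph V} {o : V} {ω : ℕ → V}

theorem eq_of_adj_of_dist_eq (hG : G.IsTree) {u x y z : V} (hy : G.Adj x y) (hz : G.Adj x z)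
    (hdy : G.dist u x = G.dist u y + 1) (hdz : G.dist u x = G.dist u z + 1) : y = z := by
  obtain ⟨p, hp⟩ := hG.connected.exists_walk_length_eq_dist y u
  obtain ⟨r, hr⟩ := hG.connected.exists_walk_length_eq_dist z u
  have hp' : (SimpleGraph.Walk.cons hy p).IsPath := by
    refine SimpleGraph.Walk.isPath_of_length_eq_dist _ ?_
    rw [SimpleGraph.Walk.length_cons, hp, G.dist_comm, G.dist_comm (u := x), hdy]
  have hr' : (SimpleGraph.Walk.cons hz r).IsPath := by
    refine SimpleGraph.Walk.isPath_of_length_eq_dist _ ?_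
    rw [SimpleGraph.Walk.length_cons, hr, G.dist_comm, G.dist_comm (u := x), hdz]
  have h := congrArg Subtype.val
    ((hG.isAcyclic.subsingleton_path x u).elim ⟨_, hp'⟩ ⟨_, hr'⟩)
  simp only [SimpleGraph.Walk.cons.injEq] at h
  exact h.1

theorem exists_adj_dist_eq (hG : G.Connected) {u x : V} (hxu : x ≠ u) :
    ∃ y, G.Adj x y ∧ G.dist u x = G.dist u y + 1 := by
  obtain ⟨p, hp⟩ := hG.exists_walk_length_eq_dist x u
  cases p with
  | nil => exact absurd rfl hxu
  | @cons _ y _ h p =>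
    refine ⟨y, h, ?_⟩
    have h1 : G.dist y u ≤ p.length := SimpleGraph.dist_le p
    have h2 := h.diff_dist_adj (u := u)
    rw [SimpleGraph.Walk.length_cons] at hp
    rw [G.dist_comm (u := u), G.dist_comm (u := u)] at *
    omega

theorem IsRay.adj (hω : IsRay G o ω) (n : ℕ) : G.Adj (ω n) (ω (n + 1)) :=
  SimpleGraph.dist_eq_one_iff_adj.1 (by simpa using hω.geodesic n 1)

/-- If the distance dropped again, `ω n` and `ω (n + 2)` would both be the neighbour of `ω (n + 1)`
towards `x`, hence equal, against geodesicity. -/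
theorem dist_ray_succ (hG : G.IsTree) (hω : IsRay G o ω) (x : V) (n : ℕ)
    (h : G.dist x (ω (n + 1)) = G.dist x (ω n) + 1) :
    G.dist x (ω (n + 2)) = G.dist x (ω (n + 1)) + 1 := by
  refine (hG.dist_eq_dist_add_one_of_adj x (hω.adj (n + 1))).resolve_left fun h' => ?_
  have := eq_of_adj_of_dist_eq hG (hω.adj n).symm (hω.adj (n + 1)) h h'
  have h2 := hω.geodesic n 2
  rw [← this, SimpleGraph.dist_self] at h2
  omega

/-- The level is a Busemann function: beyond the closest point of the ray, the distance to `x` grows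
by one at each step. This replaces the minimiser in the definition by a far point of the ray. -/
theorem exists_level_eq (hG : G.IsTree) (hω : IsRay G o ω) (x : V) :
    ∃ N, ∀ n, N ≤ n → level G o ω x = n - G.dist x (ω n) := by
  set m := Function.argmin (fun n => G.dist x (ω n)) with hm
  have hmin : ∀ n, G.dist x (ω m) ≤ G.dist x (ω n) :=
    fun n => Function.argmin_le (fun n => G.dist x (ω n)) n
  have hstep : ∀ k, G.dist x (ω (m + k + 1)) = G.dist x (ω (m + k)) + 1 := by
    intro k
    induction k with
    | zero =>
      refine (hG.dist_eq_dist_add_one_of_adj x (hω.adj m)).resolve_left fun h => ?_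
      have := hmin (m + 1)
      omega
    | succ k ih => exact dist_ray_succ hG hω x (m + k) ih
  have hd : ∀ k, G.dist x (ω (m + k)) = G.dist x (ω m) + k := by
    intro k
    induction k with
    | zero => rfl
    | succ k ih => rw [← add_assoc, hstep, ih, add_assoc]
  refine ⟨m, fun n hn => ?_⟩
  obtain ⟨k, rfl⟩ := Nat.exists_eq_add_of_le hn
  have h0 : G.dist o (ω m) = m := by
    have := hω.geodesic 0 m
    rwa [zero_add, hω.start] at this
  rw [hd, level, confluent, ← hm, h0]
  push_cast
  ring

theorem eventually_level_eq (hG : G.IsTree) (hω : IsRay G o ω) (x : V) :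
    ∀ᶠ n : ℕ in Filter.atTop, level G o ω x = n - G.dist (ω n) x ∧ x ≠ ω n := by
  obtain ⟨N, hN⟩ := exists_level_eq hG hω x
  -- The second bound puts `n` above the level of `x`, whereas `x = ω n` would make that level equal
  -- to `n`.
  filter_upwards [Filter.eventually_ge_atTop N,
    Filter.eventually_ge_atTop ((level G o ω x).toNat + 1)] with n h1 h2
  have h := hN n h1
  rw [G.dist_comm] at h
  refine ⟨h, fun hx => ?_⟩
  have h3 : G.dist (ω n) x = 0 := by rw [← hx, SimpleGraph.dist_self]
  omega

variable [G.LocallyFinite]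

theorem exists_level_neighbors_eq (hG : G.IsTree) (hω : IsRay G o ω) (x : V) :
    ∃ n : ℕ, x ≠ ω n ∧ level G o ω x = n - G.dist (ω n) x ∧
      ∀ y, G.Adj x y → level G o ω y = n - G.dist (ω n) y := by
  obtain ⟨n, h1, h2⟩ := ((eventually_level_eq hG hω x).and
    ((Filter.eventually_all_finset (G.neighborFinset x)).2
      fun y _ => eventually_level_eq hG hω y)).exists
  exact ⟨n, h1.2, h1.1, fun y hy => (h2 y ((G.mem_neighborFinset x y).2 hy)).1⟩

/-- Seen from one far ray point that computes the levels of `x` and of all its neighbours, going up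
a level means getting closer to that point, and a tree offers exactly one such neighbour. -/
theorem existsUnique_parent (hG : G.IsTree) (hω : IsRay G o ω) (x : V) :
    ∃! y, G.Adj x y ∧ level G o ω y = level G o ω x + 1 := by
  obtain ⟨n, hne, hx, hn⟩ := exists_level_neighbors_eq hG hω x
  obtain ⟨y, hy, hd⟩ := exists_adj_dist_eq hG.connected hne
  refine ⟨y, ⟨hy, ?_⟩, fun z ⟨hz, hl⟩ => ?_⟩
  · have := hn y hy
    omega
  · refine eq_of_adj_of_dist_eq hG (u := ω n) hz hy ?_ hd
    have := hn z hz
    omega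

theorem level_adj (hG : G.IsTree) (hω : IsRay G o ω) {x y : V} (h : G.Adj x y) :
    level G o ω y = level G o ω x + 1 ∨ level G o ω y = level G o ω x - 1 := by
  obtain ⟨n, -, hx, hn⟩ := exists_level_neighbors_eq hG hω x
  have h1 := hn y h
  have h2 := hG.dist_eq_dist_add_one_of_adj (ω n) h
  omega

/-- The parent of `x`: its only neighbour at level `ℓ(x) + 1`. -/
noncomputable def parent (hG : G.IsTree) (hω : IsRay G o ω) (x : V) : V :=
  (existsUnique_parent hG hω x).choose

theorem adj_parent (hG : G.IsTree) (hω : IsRay G o ω) (x : V) : G.Adj x (parent hG hω x) :=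
  (existsUnique_parent hG hω x).choose_spec.1.1

theorem level_parent (hG : G.IsTree) (hω : IsRay G o ω) (x : V) :
    level G o ω (parent hG hω x) = level G o ω x + 1 :=
  (existsUnique_parent hG hω x).choose_spec.1.2

theorem eq_parent (hG : G.IsTree) (hω : IsRay G o ω) {x y : V} (h : G.Adj x y)
    (hl : level G o ω y = level G o ω x + 1) : y = parent hG hω x :=
  (existsUnique_parent hG hω x).choose_spec.2 y ⟨h, hl⟩

theorem mem_succs_iff (hG : G.IsTree) (hω : IsRay G o ω) {x y : V} :
    y ∈ succs G o ω x ↔ parent hG hω y = x := by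
  rw [succs, Finset.mem_filter, SimpleGraph.mem_neighborFinset]
  refine ⟨fun ⟨h, hl⟩ => (eq_parent hG hω h.symm (by omega)).symm, ?_⟩
  rintro rfl
  exact ⟨(adj_parent hG hω y).symm, by rw [level_parent]; ring⟩

theorem sum_neighborFinset (hG : G.IsTree) (hω : IsRay G o ω) {M : Type*} [AddCommMonoid M]
    (F : V → M) (x : V) : ∑ y ∈ G.neighborFinset x, F y =
      F (parent hG hω x) + ∑ y ∈ succs G o ω x, F y := by
  classical
  have h : G.neighborFinset x = insert (parent hG hω x) (succs G o ω x) := by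
    ext y
    rw [Finset.mem_insert, SimpleGraph.mem_neighborFinset]
    constructor
    · intro h
      rcases level_adj hG hω h with hl | hl
      · exact Or.inl (eq_parent hG hω h hl)
      · exact Or.inr (Finset.mem_filter.2 ⟨(G.mem_neighborFinset x y).2 h, hl⟩)
    · rintro (rfl | h)
      · exact adj_parent hG hω x
      · exact (G.mem_neighborFinset x y).1 (Finset.mem_filter.1 h).1
  rw [h, Finset.sum_insert]
  intro h
  have h1 := (Finset.mem_filter.1 h).2
  rw [level_parent] at h1
  omega

variable {q : ℕ}

theorem card_succs (hG : IsHomogeneousTree G q) (hω : IsRay G o ω) (x : V) :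
    (succs G o ω x).card = q := by
  have h := sum_neighborFinset hG.isTree hω (fun _ => 1) x
  rw [← Finset.card_eq_sum_ones, ← Finset.card_eq_sum_ones, G.card_neighborFinset_eq_degree,
    hG.degree_eq] at h
  omega

theorem weight_parent (hG : IsHomogeneousTree G q) (hω : IsRay G o ω) (x : V) :
    weight G q o ω (parent hG.isTree hω x) = q * weight G q o ω x := by
  have hq : (q : ℝ) ≠ 0 := by
    have := hG.two_le
    positivity
  rw [weight, level_parent, zpow_add_one₀ hq, mul_comm, weight]

theorem weight_iterate_parent (hG : IsHomogeneousTree G q) (hω : IsRay G o ω) (x : V) (n : ℕ) :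
    weight G q o ω ((parent hG.isTree hω)^[n] x) = q ^ n * weight G q o ω x := by
  induction n with
  | zero => simp
  | succ n ih => rw [Function.iterate_succ_apply', weight_parent hG, ih, pow_succ']; ring

theorem weight_of_mem_succs (hG : IsHomogeneousTree G q) (hω : IsRay G o ω) {x y : V}
    (hy : y ∈ succs G o ω x) : weight G q o ω x = q * weight G q o ω y := by
  rw [← weight_parent hG hω, (mem_succs_iff hG.isTree hω).1 hy]

/-- Sum over the fibres of the parent map: the fibre of `z` has `q` points, each of weight `μ(z)/q`.
-/
theorem tsum_weight_comp_parent (hG : IsHomogeneousTree G q) (hω : IsRay G o ω)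
    (F : V → ℝ≥0∞) :
    ∑' x, ENNReal.ofReal (weight G q o ω x) * F (parent hG.isTree hω x) =
      ∑' x, ENNReal.ofReal (weight G q o ω x) * F x := by
  classical
  have h1 : ∀ x, ENNReal.ofReal (weight G q o ω x) * F (parent hG.isTree hω x) =
      ∑' z, if parent hG.isTree hω x = z then ENNReal.ofReal (weight G q o ω x) * F z else 0 :=
    fun x => by
      rw [tsum_eq_single (parent hG.isTree hω x) fun z hz => if_neg hz.symm, if_pos rfl]
  simp_rw [h1]
  rw [ENNReal.tsum_comm]
  refine tsum_congr fun z => ?_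
  rw [tsum_eq_sum (s := succs G o ω z)
    fun x hx => if_neg fun h => hx ((mem_succs_iff hG.isTree hω).2 h)]
  have h2 : ∀ x ∈ succs G o ω z,
      (if parent hG.isTree hω x = z then ENNReal.ofReal (weight G q o ω x) * F z else 0) =
        ENNReal.ofReal (weight G q o ω z / q) * F z := by
    intro x hx
    have hq : (q : ℝ) ≠ 0 := by
      have := hG.two_le
      positivity
    rw [if_pos ((mem_succs_iff hG.isTree hω).1 hx), weight_of_mem_succs hG hω hx,
      mul_div_cancel_left₀ _ hq]
  rw [Finset.sum_congr rfl h2, Finset.sum_const, card_succs hG hω, nsmul_eq_mul, ← mul_assoc]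
  congr 1
  have hq : (0 : ℝ) < q := by
    have := hG.two_le
    positivity
  rw [← ENNReal.ofReal_natCast, ← ENNReal.ofReal_mul hq.le, mul_div_cancel₀ _ hq.ne']

theorem measurePreserving_parent [MeasurableSpace V] [DiscreteMeasurableSpace V]
    (hG : IsHomogeneousTree G q) (hω : IsRay G o ω) :
    MeasurePreserving (parent hG.isTree hω) (flowMeasure G q o ω) (flowMeasure G q o ω) := by
  refine ⟨.of_discrete, Measure.ext fun s hs => ?_⟩
  rw [← lintegral_indicator_one hs, ← lintegral_indicator_one hs,
    lintegral_map .of_discrete .of_discrete, lintegral_flowMeasure, lintegral_flowMeasure,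
    tsum_weight_comp_parent hG hω]

end Tree

/-! ### The flow Laplacian, the gradient and the Riesz transform on `L²(μ)`. -/

theorem lp_two_enorm_sq {α : Type*} [MeasurableSpace α] {μ : Measure α}
    (f : Lp ℂ 2 μ) :
    ‖f‖ₑ ^ 2 = ∫⁻ x, ‖f x‖ₑ ^ 2 ∂μ := by
  rw [Lp.enorm_def]
  have := eLpNorm_nnreal_pow_eq_lintegral (f := f) (μ := μ) (p := 2) (by norm_num)
  simpa using this

theorem lp_one_enorm {α : Type*} [MeasurableSpace α] {μ : Measure α}
    (f : Lp ℂ 1 μ) : ‖f‖ₑ = ∫⁻ x, ‖f x‖ₑ ∂μ := by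
  rw [Lp.enorm_def, eLpNorm_one_eq_lintegral_enorm]

section FlowLp

variable {V : Type*} [MeasurableSpace V] [DiscreteMeasurableSpace V]
  {G : SimpleGraph V} [G.LocallyFinite] {q : ℕ} {o : V} {ω : ℕ → V}

theorem flowLp_add (hG : IsHomogeneousTree G q) {p : ℝ≥0∞}
    (f g : Lp ℂ p (flowMeasure G q o ω)) (x : V) : (f + g) x = f x + g x :=
  (ae_flowMeasure_iff hG).1 (Lp.coeFn_add f g) x

theorem flowLp_sub (hG : IsHomogeneousTree G q) {p : ℝ≥0∞}
    (f g : Lp ℂ p (flowMeasure G q o ω)) (x : V) : (f - g) x = f x - g x :=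
  (ae_flowMeasure_iff hG).1 (Lp.coeFn_sub f g) x

theorem flowLp_smul (hG : IsHomogeneousTree G q) {p : ℝ≥0∞} (c : ℂ)
    (f : Lp ℂ p (flowMeasure G q o ω)) (x : V) : (c • f) x = c * f x :=
  (ae_flowMeasure_iff hG).1 (Lp.coeFn_smul c f) x

theorem flowLp_zero (hG : IsHomogeneousTree G q) {p : ℝ≥0∞} (x : V) :
    (0 : Lp ℂ p (flowMeasure G q o ω)) x = 0 :=
  (ae_flowMeasure_iff hG).1 (Lp.coeFn_zero ℂ p (flowMeasure G q o ω)) x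

theorem l2Operator_apply (hG : IsHomogeneousTree G q) (A : (V → ℂ) →ₗ[ℂ] (V → ℂ))
    (hA : LocallyBounded G q o ω A) (f : Lp ℂ 2 (flowMeasure G q o ω)) (x : V) :
    l2Operator hG A hA f x = A f x := by
  obtain ⟨C, hC⟩ := eLpNorm_le_of_locallyBounded hG hA
  have hm : MemLp (A f) 2 (flowMeasure G q o ω) :=
    ⟨Measurable.of_discrete.aestronglyMeasurable, (hC f).trans_lt
      (ENNReal.mul_lt_top ENNReal.coe_lt_top (Lp.memLp f).2)⟩
  exact (ae_flowMeasure_iff hG).1 (MemLp.coeFn_toLp hm) x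

theorem flowMeasure_singleton (G : SimpleGraph V) (q : ℕ) (o : V) (ω : ℕ → V) (x : V) :
    flowMeasure G q o ω {x} = ENNReal.ofReal (weight G q o ω x) := by
  rw [← lintegral_indicator_one (.of_discrete), lintegral_flowMeasure, tsum_eq_single x]
  · simp
  · intro y hy
    simp [hy]

theorem flowMeasure_singleton_ne_top (G : SimpleGraph V) (q : ℕ) (o : V) (ω : ℕ → V) (x : V) :
    flowMeasure G q o ω {x} ≠ ∞ := by
  rw [flowMeasure_singleton]
  exact ENNReal.ofReal_ne_top

/-- The indicator function of a vertex, in `L²(μ)`. -/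
noncomputable def vertexLp (G : SimpleGraph V) (q : ℕ) (o : V) (ω : ℕ → V) (x : V) :
    Lp ℂ 2 (flowMeasure G q o ω) :=
  indicatorConstLp 2 (.of_discrete) (flowMeasure_singleton_ne_top G q o ω x) 1

theorem vertexLp_apply (hG : IsHomogeneousTree G q) (x y : V) :
    vertexLp G q o ω x y = Set.indicator {x} (fun _ => (1 : ℂ)) y :=
  (ae_flowMeasure_iff hG).1 indicatorConstLp_coeFn y

/-- Adjoints are computed below by pairing with vertex indicators through this formula. -/
theorem inner_vertexLp (hG : IsHomogeneousTree G q) (x : V)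
    (f : Lp ℂ 2 (flowMeasure G q o ω)) :
    inner ℂ (vertexLp G q o ω x) f = weight G q o ω x * f x := by
  rw [vertexLp, L2.inner_indicatorConstLp_one, integral_singleton, Measure.real,
    flowMeasure_singleton, ENNReal.toReal_ofReal (weight_pos hG x).le, Complex.real_smul]

/-- Evaluation at a vertex, as a continuous functional on `L²(μ)`. -/
noncomputable def evalLp (G : SimpleGraph V) (q : ℕ) (o : V) (ω : ℕ → V) (x : V) :
    Lp ℂ 2 (flowMeasure G q o ω) →L[ℂ] ℂ :=
  ((weight G q o ω x : ℂ)⁻¹) • innerSL ℂ (vertexLp G q o ω x)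

theorem evalLp_apply (hG : IsHomogeneousTree G q) (x : V)
    (f : Lp ℂ 2 (flowMeasure G q o ω)) : evalLp G q o ω x f = f x := by
  have h : (weight G q o ω x : ℂ) ≠ 0 := by exact_mod_cast (weight_pos hG x).ne'
  change (weight G q o ω x : ℂ)⁻¹ * inner ℂ (vertexLp G q o ω x) f = f x
  rw [inner_vertexLp hG, inv_mul_cancel_left₀ h]

theorem weight_mul_norm_sq_le (hG : IsHomogeneousTree G q) (f : Lp ℂ 2 (flowMeasure G q o ω))
    (x : V) : weight G q o ω x * ‖f x‖ ^ 2 ≤ ‖f‖ ^ 2 := by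
  have h : ENNReal.ofReal (weight G q o ω x) * ‖f x‖ₑ ^ 2 ≤ ‖f‖ₑ ^ 2 := by
    rw [lp_two_enorm_sq, lintegral_flowMeasure]
    exact ENNReal.le_tsum x
  rw [← ofReal_norm, ← ofReal_norm, ← ENNReal.ofReal_pow (norm_nonneg _),
    ← ENNReal.ofReal_pow (norm_nonneg _), ← ENNReal.ofReal_mul (weight_pos hG x).le] at h
  exact (ENNReal.ofReal_le_ofReal_iff (sq_nonneg _)).1 h

theorem weight_mul_norm_le (hG : IsHomogeneousTree G q) (f : Lp ℂ 1 (flowMeasure G q o ω))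
    (x : V) : weight G q o ω x * ‖f x‖ ≤ ‖f‖ := by
  have h : ENNReal.ofReal (weight G q o ω x) * ‖f x‖ₑ ≤ ‖f‖ₑ := by
    rw [lp_one_enorm, lintegral_flowMeasure]
    exact ENNReal.le_tsum x
  rw [← ofReal_norm, ← ofReal_norm, ← ENNReal.ofReal_mul (weight_pos hG x).le] at h
  exact (ENNReal.ofReal_le_ofReal_iff (norm_nonneg _)).1 h

/-- Composition with the parent map, as an isometry of `L²(μ)`. -/
noncomputable def parentIsometry (hG : IsHomogeneousTree G q) (hω : IsRay G o ω) :
    Lp ℂ 2 (flowMeasure G q o ω) →ₗᵢ[ℂ] Lp ℂ 2 (flowMeasure G q o ω) :=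
  Lp.compMeasurePreservingₗᵢ ℂ (parent hG.isTree hω) (measurePreserving_parent hG hω)

theorem parentIsometry_apply (hG : IsHomogeneousTree G q) (hω : IsRay G o ω)
    (f : Lp ℂ 2 (flowMeasure G q o ω)) (x : V) :
    parentIsometry hG hω f x = f (parent hG.isTree hω x) :=
  (ae_flowMeasure_iff hG).1 (Lp.coeFn_compMeasurePreserving f (measurePreserving_parent hG hω)) x

theorem parentIsometry_pow_apply (hG : IsHomogeneousTree G q) (hω : IsRay G o ω) (n : ℕ)
    (f : Lp ℂ 2 (flowMeasure G q o ω)) (x : V) :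
    (parentIsometry hG hω ^ n) f x = f ((parent hG.isTree hω)^[n] x) := by
  induction n generalizing x with
  | zero => rfl
  | succ n ih =>
    rw [isometry_pow_succ_apply, parentIsometry_apply, ih, Function.iterate_succ_apply]

/-- A fixed vector takes the same value at all ancestors of `x`, whose masses grow like `q ^ n`;
finite norm forces that value to vanish. -/
theorem eq_zero_of_parentIsometry_eq (hG : IsHomogeneousTree G q) (hω : IsRay G o ω)
    (u : Lp ℂ 2 (flowMeasure G q o ω)) (hu : parentIsometry hG hω u = u) : u = 0 := by
  refine Lp.ext <| Eventually.of_forall fun x => ?_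
  rw [flowLp_zero hG, ← norm_eq_zero, ← sq_eq_zero_iff]
  have hpow : ∀ n, (parentIsometry hG hω ^ n) u = u := by
    intro n
    induction n with
    | zero => rfl
    | succ n ih => rw [isometry_pow_succ_apply, ih, hu]
  have hb : ∀ n : ℕ, ‖u x‖ ^ 2 ≤ ‖u‖ ^ 2 / weight G q o ω x * (1 / 2) ^ n := by
    intro n
    have h := weight_mul_norm_sq_le hG u ((parent hG.isTree hω)^[n] x)
    rw [← parentIsometry_pow_apply hG, hpow, weight_iterate_parent hG] at h
    have hq : (2 : ℝ) ≤ q := by exact_mod_cast hG.two_le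
    have hw := weight_pos (o := o) (ω := ω) hG x
    have h2 : (2 : ℝ) ^ n * weight G q o ω x * ‖u x‖ ^ 2 ≤ ‖u‖ ^ 2 :=
      le_trans (by gcongr) h
    rw [one_div, inv_pow, ← div_eq_mul_inv, div_div, le_div_iff₀ (by positivity)]
    linarith
  have hlim : Tendsto (fun n : ℕ => ‖u‖ ^ 2 / weight G q o ω x * (1 / 2) ^ n) atTop (𝓝 0) := by
    simpa using (tendsto_pow_atTop_nhds_zero_of_lt_one (r := (1 / 2 : ℝ)) (by norm_num)
      (by norm_num)).const_mul (‖u‖ ^ 2 / weight G q o ω x)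
  exact le_antisymm (ge_of_tendsto' hlim hb) (sq_nonneg _)

theorem parentIsometry_vertexLp (hG : IsHomogeneousTree G q) (hω : IsRay G o ω) (x : V) :
    parentIsometry hG hω (vertexLp G q o ω x) = ∑ y ∈ succs G o ω x, vertexLp G q o ω y := by
  classical
  refine Lp.ext <| Eventually.of_forall fun z => ?_
  rw [parentIsometry_apply, vertexLp_apply hG, ← evalLp_apply hG, map_sum]
  simp only [evalLp_apply hG, vertexLp_apply hG, Set.indicator_apply, Set.mem_singleton_iff,
    Finset.sum_ite_eq, mem_succs_iff hG.isTree hω]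

theorem adjoint_parentIsometry_apply (hG : IsHomogeneousTree G q) (hω : IsRay G o ω)
    (f : Lp ℂ 2 (flowMeasure G q o ω)) (x : V) :
    adjoint (parentIsometry hG hω).toContinuousLinearMap f x =
      (1 / q : ℂ) * ∑ y ∈ succs G o ω x, f y := by
  have h := inner_vertexLp hG x (adjoint (parentIsometry hG hω).toContinuousLinearMap f)
  rw [ContinuousLinearMap.adjoint_inner_right, LinearIsometry.coe_toContinuousLinearMap,
    parentIsometry_vertexLp, sum_inner] at h
  have hw : (weight G q o ω x : ℂ) ≠ 0 := by exact_mod_cast (weight_pos hG x).ne'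
  have hq : (q : ℂ) ≠ 0 := by
    have := hG.two_le
    exact_mod_cast (by omega : q ≠ 0)
  refine mul_left_cancel₀ hw (h.symm.trans ?_)
  rw [Finset.mul_sum, Finset.mul_sum]
  refine Finset.sum_congr rfl fun y hy => ?_
  rw [inner_vertexLp hG, weight_of_mem_succs hG hω hy]
  push_cast
  field_simp

/-- The factor `√(μ(y)/μ(x))` is `√q` at the parent and `1/√q` at successors; multiplied by
`1/(2√q)` these become the weights `1/2` of `V` and `1/(2q)` of `V†/2`. -/
theorem flowLaplacian_eq (hG : IsHomogeneousTree G q) (hω : IsRay G o ω) :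
    flowLaplacian hG o ω = shiftLaplacian (parentIsometry hG hω) := by
  refine ContinuousLinearMap.ext fun f => Lp.ext <| Eventually.of_forall fun x => ?_
  rw [flowLaplacian, l2Operator_apply, shiftLaplacian_apply_complex, flowLp_sub hG,
    flowLp_smul hG, flowLp_add hG, parentIsometry_apply, adjoint_parentIsometry_apply]
  change f x - _ * _ = _
  rw [sum_neighborFinset hG.isTree hω, weight_parent hG hω]
  have hw := weight_pos (o := o) (ω := ω) hG
  have hq : (0 : ℝ) < q := by
    have := hG.two_le
    positivity
  have hsq : (√q : ℂ) * √q = q := by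
    exact_mod_cast Real.mul_self_sqrt hq.le
  have hs0 : (√q : ℂ) ≠ 0 := by exact_mod_cast (Real.sqrt_pos.2 hq).ne'
  have h1 : √(q * weight G q o ω x) / √(weight G q o ω x) = √q := by
    rw [Real.sqrt_mul hq.le, mul_div_cancel_right₀ _ (Real.sqrt_pos.2 (hw x)).ne']
  have h2 : ∑ y ∈ succs G o ω x,
      ((√(weight G q o ω y) / √(weight G q o ω x) : ℝ) : ℂ) * f y =
      (√q : ℂ)⁻¹ * ∑ y ∈ succs G o ω x, f y := by
    rw [Finset.mul_sum]
    refine Finset.sum_congr rfl fun y hy => ?_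
    have : √(weight G q o ω y) / √(weight G q o ω x) = (√q)⁻¹ := by
      rw [weight_of_mem_succs hG hω hy, Real.sqrt_mul hq.le, ← div_div, div_right_comm,
        div_self (Real.sqrt_pos.2 (hw y)).ne', one_div]
    rw [this]
    push_cast
    rfl
  rw [h1, h2, ← hsq]
  push_cast
  field_simp

variable {ε : V → ℂ} (hε : ∃ M : ℝ, ∀ x, ‖ε x‖ ≤ M)

theorem horizontalGradient_apply (hG : IsHomogeneousTree G q)
    (f : Lp ℂ 2 (flowMeasure G q o ω)) (x : V) :
    horizontalGradient hG o ω ε hε f x = (1 / (q : ℂ)) * ∑ y ∈ succs G o ω x, ε y * f y :=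
  l2Operator_apply hG _ _ f x

/-- `f ∘ p` is constant on each `s(x)`, where `ε` sums to zero. The cancellation of `ε` enters the
argument only through this identity. -/
theorem horizontalGradient_parentIsometry (hG : IsHomogeneousTree G q) (hω : IsRay G o ω)
    (hsum : ∀ x, ∑ y ∈ succs G o ω x, ε y = 0) (f : Lp ℂ 2 (flowMeasure G q o ω)) :
    horizontalGradient hG o ω ε hε (parentIsometry hG hω f) = 0 := by
  refine Lp.ext <| Eventually.of_forall fun x => ?_
  rw [horizontalGradient_apply, flowLp_zero hG]
  have h : ∀ y ∈ succs G o ω x, ε y * parentIsometry hG hω f y = ε y * f x := fun y hy => by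
    rw [parentIsometry_apply, (mem_succs_iff hG.isTree hω).1 hy]
  rw [Finset.sum_congr rfl h, ← Finset.sum_mul, hsum, zero_mul, mul_zero]

theorem adjoint_parentIsometry_adjoint_gradient (hG : IsHomogeneousTree G q)
    (hω : IsRay G o ω) (hsum : ∀ x, ∑ y ∈ succs G o ω x, ε y = 0)
    (g : Lp ℂ 2 (flowMeasure G q o ω)) :
    adjoint (parentIsometry hG hω).toContinuousLinearMap
      (adjoint (horizontalGradient hG o ω ε hε) g) = 0 := by
  refine ext_inner_left ℂ fun v => ?_
  rw [ContinuousLinearMap.adjoint_inner_right, ContinuousLinearMap.adjoint_inner_right,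
    LinearIsometry.coe_toContinuousLinearMap,
    horizontalGradient_parentIsometry hε hG hω hsum, inner_zero_left, inner_zero_right]

theorem horizontalGradient_vertexLp (hG : IsHomogeneousTree G q) (hω : IsRay G o ω) (y : V) :
    horizontalGradient hG o ω ε hε (vertexLp G q o ω y) =
      (ε y / q) • vertexLp G q o ω (parent hG.isTree hω y) := by
  classical
  refine Lp.ext <| Eventually.of_forall fun x => ?_
  rw [horizontalGradient_apply, flowLp_smul hG]
  simp only [vertexLp_apply hG, Set.indicator_apply, Set.mem_singleton_iff, mul_ite, mul_one,
    mul_zero, Finset.sum_ite_eq', mem_succs_iff hG.isTree hω, eq_comm (a := x)]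
  split_ifs <;> ring

theorem adjoint_horizontalGradient_apply (hG : IsHomogeneousTree G q) (hω : IsRay G o ω)
    (g : Lp ℂ 2 (flowMeasure G q o ω)) (y : V) :
    adjoint (horizontalGradient hG o ω ε hε) g y =
      (starRingEnd ℂ) (ε y) * g (parent hG.isTree hω y) := by
  have h := inner_vertexLp hG y (adjoint (horizontalGradient hG o ω ε hε) g)
  rw [ContinuousLinearMap.adjoint_inner_right, horizontalGradient_vertexLp hε hG hω,
    inner_smul_left, inner_vertexLp hG, weight_parent hG hω] at h
  have hw : (weight G q o ω y : ℂ) ≠ 0 := by exact_mod_cast (weight_pos hG y).ne'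
  have hq : (q : ℂ) ≠ 0 := by
    have := hG.two_le
    exact_mod_cast (by omega : q ≠ 0)
  refine mul_left_cancel₀ hw (h.symm.trans ?_)
  rw [map_div₀, Complex.conj_natCast]
  push_cast
  field_simp

theorem sqrtLaplacian_eq (hG : IsHomogeneousTree G q) (hω : IsRay G o ω) :
    sqrtLaplacian hG o ω = operatorSqrt (shiftLaplacian (parentIsometry hG hω)) := by
  rw [sqrtLaplacian, flowLaplacian_eq hG hω]

theorem adjoint_sqrtLaplacian (hG : IsHomogeneousTree G q) (hω : IsRay G o ω) :
    adjoint (sqrtLaplacian hG o ω) = sqrtLaplacian hG o ω := by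
  rw [sqrtLaplacian_eq hG hω, adjoint_sqrt_shiftLaplacian]

theorem sqrtLaplacian_injective (hG : IsHomogeneousTree G q) (hω : IsRay G o ω) :
    Function.Injective (sqrtLaplacian hG o ω) := by
  rw [sqrtLaplacian_eq hG hω]
  exact sqrt_shiftLaplacian_injective _ (eq_zero_of_parentIsometry_eq hG hω)

theorem horizontalRiesz_domain (hG : IsHomogeneousTree G q) :
    (horizontalRiesz hG o ω ε hε).domain = (sqrtLaplacian hG o ω).range := by
  change (invSqrtLaplacian hG o ω).domain = _
  rw [invSqrtLaplacian, LinearPMap.inverse_domain]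
  ext y
  constructor
  · rintro ⟨x, rfl⟩
    exact ⟨x, rfl⟩
  · rintro ⟨x, rfl⟩
    exact ⟨⟨x, trivial⟩, rfl⟩

theorem horizontalRiesz_apply (hG : IsHomogeneousTree G q) (hω : IsRay G o ω)
    (x : (horizontalRiesz hG o ω ε hε).domain) (u : Lp ℂ 2 (flowMeasure G q o ω))
    (hu : sqrtLaplacian hG o ω u = x) :
    horizontalRiesz hG o ω ε hε x = horizontalGradient hG o ω ε hε u := by
  have hker : LinearMap.ker ((sqrtLaplacian hG o ω).toPMap ⊤).toFun = ⊥ :=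
    LinearMap.ker_eq_bot.2 fun a b hab => Subtype.ext (sqrtLaplacian_injective hG hω hab)
  change horizontalGradient hG o ω ε hε (invSqrtLaplacian hG o ω x) = _
  congr 1
  exact LinearPMap.inverse_apply_eq hker (x := ⟨u, trivial⟩) hu

/-- The orthogonal complement of the range of a self-adjoint operator is its kernel, here zero. -/
theorem dense_horizontalRiesz_domain (hG : IsHomogeneousTree G q) (hω : IsRay G o ω) :
    Dense ((horizontalRiesz hG o ω ε hε).domain : Set (Lp ℂ 2 (flowMeasure G q o ω))) := by
  rw [horizontalRiesz_domain, Submodule.dense_iff_topologicalClosure_eq_top,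
    Submodule.topologicalClosure_eq_top_iff, ContinuousLinearMap.orthogonal_range,
    adjoint_sqrtLaplacian hG hω]
  exact LinearMap.ker_eq_bot.2 (sqrtLaplacian_injective hG hω)

/-- The everywhere defined adjoint of the horizontal Riesz transform, as a series. -/
theorem exists_hasSum_adjoint_horizontalRiesz (hG : IsHomogeneousTree G q) (hω : IsRay G o ω)
    (hsum : ∀ x, ∑ y ∈ succs G o ω x, ε y = 0) (g : Lp ℂ 2 (flowMeasure G q o ω)) :
    ∃ h, HasSum (fun n => (rieszCoeff n : ℂ) • (parentIsometry hG hω ^ n)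
      (adjoint (horizontalGradient hG o ω ε hε) g)) h ∧
      ∀ x : (horizontalRiesz hG o ω ε hε).domain,
        inner ℂ h (x : Lp ℂ 2 (flowMeasure G q o ω)) =
          inner ℂ g (horizontalRiesz hG o ω ε hε x) := by
  have hw := adjoint_parentIsometry_adjoint_gradient hε hG hω hsum g
  obtain ⟨h, hh⟩ := summable_rieszCoeff_smul _ hw
  refine ⟨h, hh, fun x => ?_⟩
  have hA := sqrt_shiftLaplacian_apply _ (eq_zero_of_parentIsometry_eq hG hω) hw hh
  rw [← sqrtLaplacian_eq hG hω] at hA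
  obtain ⟨u, hu⟩ : (x : Lp ℂ 2 (flowMeasure G q o ω)) ∈ (sqrtLaplacian hG o ω).range :=
    horizontalRiesz_domain hε hG ▸ x.2
  change sqrtLaplacian hG o ω u = x at hu
  rw [horizontalRiesz_apply hε hG hω x u hu, ← hu, ← ContinuousLinearMap.adjoint_inner_left,
    adjoint_sqrtLaplacian hG hω, hA, ContinuousLinearMap.adjoint_inner_left]

theorem adjoint_horizontalRiesz_domain (hG : IsHomogeneousTree G q) (hω : IsRay G o ω)
    (hsum : ∀ x, ∑ y ∈ succs G o ω x, ε y = 0) :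
    (horizontalRiesz hG o ω ε hε).adjoint.domain = ⊤ := by
  refine Submodule.eq_top_iff'.2 fun g => ?_
  obtain ⟨h, -, hh⟩ := exists_hasSum_adjoint_horizontalRiesz hε hG hω hsum g
  exact LinearPMap.mem_adjoint_domain_of_exists g ⟨h, hh⟩

/-- Evaluation at a vertex is continuous on `L²(μ)`, so the norm-convergent series may be evaluated
term by term. -/
theorem hasSum_adjoint_horizontalRiesz_apply (hG : IsHomogeneousTree G q) (hω : IsRay G o ω)
    (hsum : ∀ x, ∑ y ∈ succs G o ω x, ε y = 0)
    (g : (horizontalRiesz hG o ω ε hε).adjoint.domain) (x : V) :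
    HasSum (fun n => rieszCoeff n * ((starRingEnd ℂ) (ε ((parent hG.isTree hω)^[n] x)) *
      (g : Lp ℂ 2 (flowMeasure G q o ω)) ((parent hG.isTree hω)^[n + 1] x)))
      ((horizontalRiesz hG o ω ε hε).adjoint g x) := by
  obtain ⟨h, hh, hadj⟩ := exists_hasSum_adjoint_horizontalRiesz hε hG hω hsum g
  rw [LinearPMap.adjoint_apply_eq (dense_horizontalRiesz_domain hε hG hω) g hadj]
  have h1 := (evalLp G q o ω x).hasSum hh
  simp only [evalLp_apply hG] at h1
  convert! h1 using 2 with n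
  rw [flowLp_smul hG, parentIsometry_pow_apply, adjoint_horizontalGradient_apply hε hG hω,
    Function.iterate_succ_apply']

end FlowLp

/-! ### The weak-type estimate by truncation at growing heights. -/

theorem sum_ite_succ_le {a : ℝ} (ha : 0 ≤ a) (N : ℕ) :
    ∑ n ∈ Finset.range N, (if (n + 1 : ℝ) ≤ a then (1 : ℝ) else 0) ≤ a := by
  have h : ∑ n ∈ Finset.range N, (if (n + 1 : ℝ) ≤ a then (1 : ℝ) else 0) ≤ min (N : ℝ) a := by
    induction N with
    | zero => simp [ha]
    | succ N ih =>
      rw [Finset.sum_range_succ]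
      push_cast
      have h1 := ih.trans (min_le_left _ _)
      have h2 := ih.trans (min_le_right _ _)
      split_ifs with h3
      · exact le_min (by linarith) (by linarith)
      · exact le_min (by linarith) (by linarith)
  exact h.trans (min_le_right _ _)

/-- With `a = |f|/t` this sums the squared coefficients over those `n` whose truncation keeps the
value `f`. -/
theorem sum_ite_sq_div_le {a : ℝ} (ha : 0 ≤ a) (N : ℕ) :
    ∑ n ∈ Finset.range N, (if a < n + 1 then a ^ 2 / (n + 1 : ℝ) ^ 2 else 0) ≤ 2 * a := by
  -- Below the threshold the sum is empty; above it the subtracted `2a²/(N+1)` dominates the tail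
  -- still to come, so that the induction telescopes.
  have key : ∀ N : ℕ, ((N : ℝ) ≤ a → ∑ n ∈ Finset.range N,
      (if a < n + 1 then a ^ 2 / (n + 1 : ℝ) ^ 2 else 0) = 0) ∧
      (a ≤ N + 1 → ∑ n ∈ Finset.range N, (if a < n + 1 then a ^ 2 / (n + 1 : ℝ) ^ 2 else 0) ≤
        2 * a - 2 * a ^ 2 / (N + 1)) := by
    intro N
    induction N with
    | zero =>
      refine ⟨fun _ => by simp, fun h => ?_⟩
      simp only [Finset.range_zero, Finset.sum_empty, Nat.cast_zero, zero_add, div_one] at h ⊢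
      nlinarith
    | succ N ih =>
      rw [Finset.sum_range_succ]
      push_cast
      refine ⟨fun h => ?_, fun h => ?_⟩
      · rw [ih.1 (by linarith), if_neg (by linarith), add_zero]
      · have hN : (0 : ℝ) < N + 1 := by positivity
        split_ifs with h1
        · have h2 := ih.2 h1.le
          have h3 : a ^ 2 / (N + 1 : ℝ) ^ 2 ≤ 2 * a ^ 2 / (N + 1) - 2 * a ^ 2 / (N + 1 + 1) := by
            rw [div_sub_div _ _ hN.ne' (by positivity),
              div_le_div_iff₀ (by positivity) (by positivity)]
            have : 0 ≤ a ^ 2 * N * (N + 1) := by positivity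
            nlinarith
          linarith
        · rw [ih.1 (by linarith), add_zero, sub_nonneg, div_le_iff₀ (by positivity)]
          nlinarith
  rcases le_total a (N + 1) with h | h
  · refine ((key N).2 h).trans ?_
    have : 0 ≤ 2 * a ^ 2 / (N + 1 : ℝ) := by positivity
    linarith
  · rw [(key N).1 (by linarith)]
    positivity

/-- The `n`-th truncation of an integrable function at height `t`, scaled by the `n`-th
coefficient. -/
noncomputable def truncation {V : Type*} (f : V → ℂ) (t : ℝ) (n : ℕ) (x : V) : ℂ :=
  if ‖f x‖ < t * (n + 1) then rieszCoeff n * f x else 0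

theorem memLp_truncation {V : Type*} [MeasurableSpace V] [DiscreteMeasurableSpace V]
    {μ : Measure V} (f : Lp ℂ 1 μ) {t : ℝ} (ht : 0 < t) (n : ℕ) : MemLp (truncation f t n) 2 μ := by
  rw [memLp_two_iff_integrable_sq_norm Measurable.of_discrete.aestronglyMeasurable]
  have hf : Integrable f μ := L1.integrable_coeFn f
  refine (hf.norm.const_mul (rieszCoeff n ^ 2 * (t * (n + 1)))).mono'
    Measurable.of_discrete.aestronglyMeasurable (Eventually.of_forall fun x => ?_)
  rw [truncation, Real.norm_of_nonneg (sq_nonneg _)]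
  split_ifs with h
  · rw [norm_mul, Complex.norm_real, Real.norm_of_nonneg (rieszCoeff_nonneg n), mul_pow, sq ‖f x‖,
      mul_assoc (rieszCoeff n ^ 2)]
    gcongr
  · simp only [norm_zero, ne_eq, OfNat.ofNat_ne_zero, not_false_eq_true, zero_pow]
    positivity

section WeakType

variable {V : Type*} {G : SimpleGraph V} [G.LocallyFinite] {q : ℕ} {o : V} {ω : ℕ → V}

/-- The `n`-th term of the series defining the adjoint of the horizontal Riesz transform. -/
noncomputable def adjointRieszTerm (hG : IsHomogeneousTree G q) (hω : IsRay G o ω) (ε : V → ℂ)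
    (f : V → ℂ) (n : ℕ) (x : V) : ℂ :=
  rieszCoeff n * ((starRingEnd ℂ) (ε ((parent hG.isTree hω)^[n] x)) *
    f ((parent hG.isTree hω)^[n + 1] x))

/-- The constant is `8 = 4 · 2`: `4` from squaring `c_n ≤ 2/(n+1)`, `2` from `sum_ite_sq_div_le`. -/
theorem sum_enorm_truncation_sq_le (f : V → ℂ) {t : ℝ} (ht : 0 < t) (N : ℕ) (x : V) :
    ∑ n ∈ Finset.range N, ‖truncation f t n x‖ₑ ^ 2 ≤ ENNReal.ofReal (8 * t) * ‖f x‖ₑ := by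
  have h1 : ∀ n, ‖truncation f t n x‖ ^ 2 ≤ 4 * t ^ 2 *
      (if ‖f x‖ / t < n + 1 then (‖f x‖ / t) ^ 2 / (n + 1 : ℝ) ^ 2 else 0) := by
    intro n
    simp only [truncation, div_lt_iff₀ ht, mul_comm t]
    split_ifs
    · rw [norm_mul, Complex.norm_real, Real.norm_of_nonneg (rieszCoeff_nonneg n)]
      calc (rieszCoeff n * ‖f x‖) ^ 2 ≤ (2 / (n + 1) * ‖f x‖) ^ 2 := by
            have := rieszCoeff_nonneg n
            gcongr
            exact rieszCoeff_le n
        _ = _ := by field_simp; ring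
    · simp
  have h2 : ∑ n ∈ Finset.range N, ‖truncation f t n x‖ ^ 2 ≤ 8 * t * ‖f x‖ := by
    refine (Finset.sum_le_sum fun n _ => h1 n).trans ?_
    rw [← Finset.mul_sum]
    calc _ ≤ 4 * t ^ 2 * (2 * (‖f x‖ / t)) := by
          gcongr
          exact sum_ite_sq_div_le (by positivity) N
      _ = _ := by field_simp; ring
  simp only [← ofReal_norm, ← ENNReal.ofReal_pow (norm_nonneg _)]
  rw [← ENNReal.ofReal_sum_of_nonneg fun n _ => sq_nonneg _,
    ← ENNReal.ofReal_mul (by positivity)]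
  exact ENNReal.ofReal_le_ofReal h2

variable [MeasurableSpace V] [DiscreteMeasurableSpace V] {ε : V → ℂ}

/-- The value of an `L¹` function at the `n`-th ancestor is at most `‖f‖/(q^n μ(x))`, so the series
converges geometrically at every vertex and defines the extension without a density argument. -/
theorem summable_adjointRieszTerm (hε : ∃ M : ℝ, ∀ x, ‖ε x‖ ≤ M) (hG : IsHomogeneousTree G q)
    (hω : IsRay G o ω) (f : Lp ℂ 1 (flowMeasure G q o ω)) (x : V) :
    Summable fun n => adjointRieszTerm hG hω ε f n x := by
  obtain ⟨M, hM⟩ := hε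
  have hM0 : 0 ≤ M := (norm_nonneg _).trans (hM o)
  have hw := weight_pos (o := o) (ω := ω) hG x
  have hq : (2 : ℝ) ≤ q := by exact_mod_cast hG.two_le
  refine Summable.of_norm_bounded (g := fun n : ℕ => 2 * M * (‖f‖ / weight G q o ω x) *
    (1 / 2) ^ n) ((summable_geometric_of_lt_one (by norm_num) (by norm_num)).mul_left _) ?_
  intro n
  rw [adjointRieszTerm, norm_mul, norm_mul, RCLike.norm_conj, Complex.norm_real,
    Real.norm_of_nonneg (rieszCoeff_nonneg n)]
  have h1 : rieszCoeff n ≤ 2 := (rieszCoeff_le n).trans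
    (div_le_self zero_le_two (by linarith [(Nat.cast_nonneg n : (0 : ℝ) ≤ n)]))
  have h2 : ‖f ((parent hG.isTree hω)^[n + 1] x)‖ ≤ ‖f‖ / weight G q o ω x * (1 / 2) ^ n := by
    have h := weight_mul_norm_le hG f ((parent hG.isTree hω)^[n + 1] x)
    rw [weight_iterate_parent hG] at h
    rw [one_div, inv_pow, ← div_eq_mul_inv, div_div, le_div_iff₀ (by positivity)]
    have h3 : (2 : ℝ) ^ n ≤ (q : ℝ) ^ (n + 1) :=
      (pow_le_pow_left₀ (by norm_num) hq n).trans
        (pow_le_pow_right₀ (by linarith) (Nat.le_succ n))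
    have h4 : (2 : ℝ) ^ n * weight G q o ω x * ‖f ((parent hG.isTree hω)^[n + 1] x)‖ ≤ ‖f‖ :=
      le_trans (by gcongr) h
    linarith
  calc _ ≤ 2 * (M * (‖f‖ / weight G q o ω x * (1 / 2) ^ n)) := by
        gcongr
        exact hM _
    _ = _ := by ring

/-- The extension to `L¹(μ)` of the adjoint of the horizontal Riesz transform. -/
noncomputable def adjointRieszL1 (hε : ∃ M : ℝ, ∀ x, ‖ε x‖ ≤ M) (hG : IsHomogeneousTree G q)
    (hω : IsRay G o ω) :
    Lp ℂ 1 (flowMeasure G q o ω) →ₗ[ℂ] (V →ₘ[flowMeasure G q o ω] ℂ) where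
  toFun f := AEEqFun.mk (fun x => ∑' n, adjointRieszTerm hG hω ε f n x)
    Measurable.of_discrete.aestronglyMeasurable
  map_add' f g := by
    rw [AEEqFun.mk_add_mk, AEEqFun.mk_eq_mk]
    refine Eventually.of_forall fun x => ?_
    rw [Pi.add_apply, ← (summable_adjointRieszTerm hε hG hω f x).tsum_add
      (summable_adjointRieszTerm hε hG hω g x)]
    refine tsum_congr fun n => ?_
    simp only [adjointRieszTerm, flowLp_add hG]
    ring
  map_smul' c f := by
    rw [RingHom.id_apply, AEEqFun.smul_mk, AEEqFun.mk_eq_mk]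
    refine Eventually.of_forall fun x => ?_
    rw [Pi.smul_apply, smul_eq_mul, ← tsum_mul_left]
    refine tsum_congr fun n => ?_
    simp only [adjointRieszTerm, flowLp_smul hG]
    ring

theorem adjointRieszL1_apply (hε : ∃ M : ℝ, ∀ x, ‖ε x‖ ≤ M) (hG : IsHomogeneousTree G q)
    (hω : IsRay G o ω) (f : Lp ℂ 1 (flowMeasure G q o ω)) (x : V) :
    adjointRieszL1 hε hG hω f x = ∑' n, adjointRieszTerm hG hω ε f n x :=
  (ae_flowMeasure_iff hG).1 (AEEqFun.coeFn_mk _ _) x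

theorem norm_adjoint_horizontalGradient_le {M : ℝ} (hM : ∀ x, ‖ε x‖ ≤ M)
    (hG : IsHomogeneousTree G q) (hω : IsRay G o ω) (g : Lp ℂ 2 (flowMeasure G q o ω)) :
    ‖adjoint (horizontalGradient hG o ω ε ⟨M, hM⟩) g‖ ≤ M * ‖g‖ := by
  rw [← (parentIsometry hG hω).norm_map g]
  refine Lp.norm_le_mul_norm_of_ae_le_mul (Eventually.of_forall fun x => ?_)
  rw [adjoint_horizontalGradient_apply _ hG hω, parentIsometry_apply, norm_mul, RCLike.norm_conj]
  gcongr
  exact hM x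

/-- By invariance of `μ` the `n`-th preimage has measure `μ{|f| ≥ t(n+1)}`, and the number of `n`
with `n + 1 ≤ |f|/t` is at most `|f|/t`. -/
theorem measure_exceptional_le (hG : IsHomogeneousTree G q) (hω : IsRay G o ω)
    (f : Lp ℂ 1 (flowMeasure G q o ω)) {t : ℝ} (ht : 0 < t) (N : ℕ) :
    flowMeasure G q o ω {x | ∃ n < N, t * (n + 1) ≤ ‖f ((parent hG.isTree hω)^[n + 1] x)‖} ≤
      ‖f‖ₑ / ENNReal.ofReal t := by
  calc _ ≤ flowMeasure G q o ω (⋃ n ∈ Finset.range N,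
        (parent hG.isTree hω)^[n + 1] ⁻¹' {z | t * (n + 1) ≤ ‖f z‖}) := by
        refine measure_mono ?_
        rintro x ⟨n, hn, h⟩
        exact Set.mem_biUnion (Finset.mem_range.2 hn) h
    _ ≤ ∑ n ∈ Finset.range N, flowMeasure G q o ω
        ((parent hG.isTree hω)^[n + 1] ⁻¹' {z | t * (n + 1) ≤ ‖f z‖}) :=
        measure_biUnion_finset_le _ _
    _ = ∑ n ∈ Finset.range N, ∫⁻ z,
        ENNReal.ofReal (if (n + 1 : ℝ) ≤ ‖f z‖ / t then 1 else 0) ∂flowMeasure G q o ω := by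
        refine Finset.sum_congr rfl fun n _ => ?_
        rw [((measurePreserving_parent hG hω).iterate (n + 1)).measure_preimage
          (MeasurableSet.of_discrete).nullMeasurableSet, ← lintegral_indicator_one .of_discrete]
        refine lintegral_congr fun z => ?_
        simp only [Set.indicator_apply, Set.mem_ofPred_eq, le_div_iff₀ ht, mul_comm t,
          Pi.one_apply]
        split_ifs <;> simp
    _ = ∫⁻ z, ∑ n ∈ Finset.range N,
        ENNReal.ofReal (if (n + 1 : ℝ) ≤ ‖f z‖ / t then 1 else 0) ∂flowMeasure G q o ω :=
        (lintegral_finsetSum _ fun _ _ => .of_discrete).symm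
    _ ≤ ∫⁻ z, ‖f z‖ₑ / ENNReal.ofReal t ∂flowMeasure G q o ω := by
        refine lintegral_mono fun z => ?_
        rw [← ENNReal.ofReal_sum_of_nonneg fun n _ => by split_ifs <;> norm_num, ← ofReal_norm,
          ← ENNReal.ofReal_div_of_pos ht]
        exact ENNReal.ofReal_le_ofReal (sum_ite_succ_le (by positivity) N)
    _ = ‖f‖ₑ / ENNReal.ofReal t := by
        simp only [div_eq_mul_inv]
        rw [lintegral_mul_const _ .of_discrete, lp_one_enorm]

/-- Off the exceptional set the partial sum equals `T`, built from the truncations. The terms of `T`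
are orthogonal, so `‖T‖² ≤ 8M²t‖f‖`; the `1` in the constant pays for the exceptional set. -/
theorem measure_partialSum_le {M : ℝ} (hM : ∀ x, ‖ε x‖ ≤ M) (hG : IsHomogeneousTree G q)
    (hω : IsRay G o ω) (hsum : ∀ x, ∑ y ∈ succs G o ω x, ε y = 0)
    (f : Lp ℂ 1 (flowMeasure G q o ω)) {t : ℝ} (ht : 0 < t) (N : ℕ) :
    flowMeasure G q o ω {x | t < ‖∑ n ∈ Finset.range N, adjointRieszTerm hG hω ε f n x‖} ≤
      ENNReal.ofReal ((1 + 8 * M ^ 2) * ‖f‖ / t) := by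
  set p := parent hG.isTree hω with hp
  have hM0 : 0 ≤ M := (norm_nonneg _).trans (hM o)
  set D := adjoint (horizontalGradient hG o ω ε ⟨M, hM⟩) with hD
  let h : ℕ → Lp ℂ 2 (flowMeasure G q o ω) := fun n => (memLp_truncation f ht n).toLp
  have hh : ∀ n x, h n x = truncation f t n x := fun n x =>
    (ae_flowMeasure_iff hG).1 (MemLp.coeFn_toLp (memLp_truncation f ht n)) x
  set T : Lp ℂ 2 (flowMeasure G q o ω) :=
    ∑ n ∈ Finset.range N, (parentIsometry hG hω ^ n) (D (h n)) with hT
  have hTx : ∀ x, (∀ n < N, ‖f (p^[n + 1] x)‖ < t * (n + 1)) →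
      T x = ∑ n ∈ Finset.range N, adjointRieszTerm hG hω ε f n x := by
    intro x hx
    rw [← evalLp_apply hG, hT, map_sum]
    refine Finset.sum_congr rfl fun n hn => ?_
    rw [evalLp_apply hG, parentIsometry_pow_apply, hD, adjoint_horizontalGradient_apply _ hG hω, hh,
      ← Function.iterate_succ_apply' (parent hG.isTree hω), truncation,
      if_pos (hx n (Finset.mem_range.1 hn)), adjointRieszTerm]
    ring
  have hTn : ‖T‖ₑ ^ 2 ≤ ENNReal.ofReal (M ^ 2 * (8 * t) * ‖f‖) := by
    have h1 : ‖T‖ ^ 2 ≤ M ^ 2 * ∑ n ∈ Finset.range N, ‖h n‖ ^ 2 := by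
      rw [hT, norm_sum_pow_sq _ fun n =>
        adjoint_parentIsometry_adjoint_gradient _ hG hω hsum (h n), Finset.mul_sum]
      refine Finset.sum_le_sum fun n _ => ?_
      rw [← mul_pow]
      exact pow_le_pow_left₀ (norm_nonneg _) (norm_adjoint_horizontalGradient_le hM hG hω _) 2
    have h2 : ∑ n ∈ Finset.range N, ‖h n‖ₑ ^ 2 ≤ ENNReal.ofReal (8 * t) * ‖f‖ₑ := by
      simp only [lp_two_enorm_sq, hh]
      rw [← lintegral_finsetSum _ fun _ _ => .of_discrete, lp_one_enorm,
        ← lintegral_const_mul _ .of_discrete]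
      exact lintegral_mono fun x => sum_enorm_truncation_sq_le f ht N x
    rw [← ofReal_norm, ← ENNReal.ofReal_pow (norm_nonneg _)]
    refine (ENNReal.ofReal_le_ofReal h1).trans ?_
    rw [ENNReal.ofReal_mul (sq_nonneg _), ENNReal.ofReal_sum_of_nonneg fun n _ => sq_nonneg _,
      mul_assoc, ENNReal.ofReal_mul (sq_nonneg _), ENNReal.ofReal_mul (by positivity), ofReal_norm]
    gcongr
    refine le_trans (le_of_eq ?_) h2
    exact Finset.sum_congr rfl fun n _ => by
      rw [ENNReal.ofReal_pow (norm_nonneg _), ofReal_norm]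
  have hTm : flowMeasure G q o ω {x | t < ‖T x‖} ≤ ENNReal.ofReal (8 * M ^ 2 * ‖f‖ / t) := by
    calc _ ≤ flowMeasure G q o ω {x | ENNReal.ofReal t ^ 2 ≤ ‖T x‖ₑ ^ 2} := by
          refine measure_mono fun x hx => ?_
          rw [Set.mem_ofPred_eq, ← ofReal_norm]
          gcongr
          exact le_of_lt hx
      _ ≤ (∫⁻ x, ‖T x‖ₑ ^ 2 ∂flowMeasure G q o ω) / ENNReal.ofReal t ^ 2 :=
          meas_ge_le_lintegral_div .of_discrete (by positivity) (by finiteness)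
      _ ≤ ENNReal.ofReal (M ^ 2 * (8 * t) * ‖f‖) / ENNReal.ofReal t ^ 2 := by
          rw [← lp_two_enorm_sq]
          gcongr
      _ = ENNReal.ofReal (8 * M ^ 2 * ‖f‖ / t) := by
          rw [← ENNReal.ofReal_pow ht.le, ← ENNReal.ofReal_div_of_pos (by positivity)]
          congr 1
          field_simp
  calc _ ≤ flowMeasure G q o ω
        ({x | ∃ n < N, t * (n + 1) ≤ ‖f (p^[n + 1] x)‖} ∪ {x | t < ‖T x‖}) := by
        refine measure_mono fun x hx => ?_
        by_cases hxE : ∃ n < N, t * (n + 1) ≤ ‖f (p^[n + 1] x)‖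
        · exact Or.inl hxE
        · push Not at hxE
          refine Or.inr ?_
          rw [Set.mem_ofPred_eq, hTx x hxE]
          exact hx
    _ ≤ ‖f‖ₑ / ENNReal.ofReal t + ENNReal.ofReal (8 * M ^ 2 * ‖f‖ / t) :=
        (measure_union_le _ _).trans (add_le_add (measure_exceptional_le hG hω f ht N) hTm)
    _ = _ := by
        rw [← ofReal_norm, ← ENNReal.ofReal_div_of_pos ht,
          ← ENNReal.ofReal_add (by positivity) (by positivity)]
        congr 1
        ring

/-- The strict inequality is an open condition, so `{t < |g|}` lies in the increasing union of the
sets where it holds for all later indices. -/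
theorem measure_lt_norm_le_of_tendsto {α : Type*} [MeasurableSpace α] {μ : Measure α}
    {F : ℕ → α → ℂ} {g : α → ℂ} (hg : ∀ x, Tendsto (fun n => F n x) atTop (𝓝 (g x))) {t : ℝ}
    {B : ℝ≥0∞} (hB : ∀ n, μ {x | t < ‖F n x‖} ≤ B) : μ {x | t < ‖g x‖} ≤ B := by
  have hmono : Monotone fun N : ℕ => {x | ∀ k ≥ N, t < ‖F k x‖} :=
    fun m n hmn x hx k hk => hx k (le_trans hmn hk)
  calc _ ≤ μ (⋃ N : ℕ, {x | ∀ k ≥ N, t < ‖F k x‖}) := by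
        refine measure_mono fun x hx => ?_
        obtain ⟨N, hN⟩ := eventually_atTop.1 ((hg x).norm.eventually (lt_mem_nhds hx))
        exact Set.mem_iUnion.2 ⟨N, hN⟩
    _ = ⨆ N : ℕ, μ {x | ∀ k ≥ N, t < ‖F k x‖} := hmono.measure_iUnion
    _ ≤ B := iSup_le fun N =>
        (measure_mono fun x (hx : ∀ k ≥ N, t < ‖F k x‖) => hx N le_rfl).trans (hB N)

theorem isWeakTypeOneOne_adjoint_horizontalRiesz (hε : ∃ M : ℝ, ∀ x, ‖ε x‖ ≤ M)
    (hG : IsHomogeneousTree G q) (hω : IsRay G o ω)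
    (hsum : ∀ x, ∑ y ∈ succs G o ω x, ε y = 0) :
    IsWeakTypeOneOne (horizontalRiesz hG o ω ε hε).adjoint := by
  obtain ⟨M, hM⟩ := id hε
  refine ⟨adjointRieszL1 hε hG hω, ⟨1 + 8 * M ^ 2, by positivity⟩, fun f g hfg => ?_,
    fun f t ht => ?_⟩
  · rw [EventuallyEq, ae_flowMeasure_iff hG] at hfg
    refine Eventually.of_forall fun x => ?_
    rw [adjointRieszL1_apply, ← (hasSum_adjoint_horizontalRiesz_apply hε hG hω hsum g x).tsum_eq]
    simp only [adjointRieszTerm, hfg]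
  · simp only [adjointRieszL1_apply]
    exact measure_lt_norm_le_of_tendsto
      (fun x => (summable_adjointRieszTerm hε hG hω f x).hasSum.tendsto_sum_nat)
      fun N => measure_partialSum_le hM hG hω hsum f ht N

end WeakType

end FlowTree

/-- The adjoint of the horizontal Riesz transform on a homogeneous tree with its canonical flow
measure is of weak type `(1,1)`. The first three conjuncts say that `𝓛^{-1/2}`, the horizontal
Riesz transform and its adjoint are well defined, the adjoint on the whole of `L²(μ)`. -/
theorem theorem5p6 {V : Type*} [MeasurableSpace V] [DiscreteMeasurableSpace V]
    (G : SimpleGraph V) [G.LocallyFinite] (q : ℕ) (hG : FlowTree.IsHomogeneousTree G q)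
    (o : V) (ω : ℕ → V) (hω : FlowTree.IsRay G o ω)
    (ε : V → ℂ) (hε : ∃ M : ℝ, ∀ x, ‖ε x‖ ≤ M)
    (hsum : ∀ x, ∑ y ∈ FlowTree.succs G o ω x, ε y = 0) :
    Function.Injective (FlowTree.sqrtLaplacian hG o ω) ∧
    Dense ((FlowTree.horizontalRiesz hG o ω ε hε).domain :
      Set (Lp ℂ 2 (FlowTree.flowMeasure G q o ω))) ∧
    (FlowTree.horizontalRiesz hG o ω ε hε).adjoint.domain = ⊤ ∧
    FlowTree.IsWeakTypeOneOne (FlowTree.horizontalRiesz hG o ω ε hε).adjoint := by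
  exact ⟨FlowTree.sqrtLaplacian_injective hG hω,
    FlowTree.dense_horizontalRiesz_domain hε hG hω,
    FlowTree.adjoint_horizontalRiesz_domain hε hG hω hsum,
    FlowTree.isWeakTypeOneOne_adjoint_horizontalRiesz hε hG hω hsum⟩
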